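/- Let $d,N\in\mathbb N_0$, let $\mathcal S=\mathcal S(\mathbb R^d,\mathbb C^N)$ be the space of Schwartz functions, and for $n\in\mathbb N_0$ let $\mathcal S^{\otimes n}=\mathcal S\big((\mathbb R^d)^n,(\mathbb C^N)^{\otimes n}\big)$ be its (completed) $n$-fold tensor power. Let $W_n$ ($n\in\mathbb N_0$) and $W_n^T$ ($n\in\mathbb N$) be continuous linear functionals on $\mathcal S^{\otimes n}$, where $\{W_n^T\}$ is the truncation of $\{W_n\}$: for all $n\ge 1$ and $f_1,\dots,f_n\in\mathcal S$, $$W_n(f_1\otimes\cdots\otimes f_n)=\sum_{I\in\mathcal P^{(n)}}\ \prod_{\substack{\{j_1,\dots,j_l\}\in I\\ j_1<\cdots<j_l}}W_l^T(f_{j_1}\otimes\cdots\otimes f_{j_l}),$$ where $\mathcal P^{(n)}$ is the set of all partitions of $\{1,\dots,n\}$ into disjoint nonempty sets. Suppose there is one norm $\|\cdot\|$ on $\mathcal S$, continuous for the Schwartz topology, such that for every $n\ge 1$ the functional $W_n^T$ is continuous with respect to $\|\cdot\|^{\otimes n}$, i.e. there is $C_n<\infty$ with $|W_n^T(F)|\le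 C_n\|F\|^{\otimes n}$ for all $F$ in the algebraic $n$-fold tensor power of $\mathcal S$ (the linear span of the products $f_1\otimes\cdots\otimes f_n$), where $$\|F\|^{\otimes n}=\inf\Big\{\sum_{j}|c_j|\,\|f_{j,1}\|\cdots\|f_{j,n}\| \;:\; F=\sum_{j}c_j\, f_{j,1}\otimes\cdots\otimes f_{j,n}\ \text{(finite sum)}\Big\}$$ is the projective tensor norm. Then $\{W_n\}$ satisfies the Hilbert space structure condition: for every $n\in\mathbb N_0$ there is a Hilbert seminorm $p_n$ on $\mathcal S^{\otimes n}$ (a continuous seminorm with $p_n(f)^2=\langle f,f\rangle_n$ for some positive semidefinite Hermitian sesquilinear form $\langle\cdot,\cdot\rangle_n$) such that $$|W_{n+m}(f\otimes h)|\le p_n(f)\,p_m(h)\qquad\text{for all } n,m\in\mathbb N_0,\ f\in\mathcal S^{\otimes n},\ h\in\mathcal S^{\otimes m}.$$ -/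

import Mathlib

open scoped SchwartzMap ContDiff

noncomputable section

namespace Wightman

/-- Space-time `ℝ^d`. -/
abbrev Spacetime (d : ℕ) : Type := EuclideanSpace ℝ (Fin d)

/-- The one-particle test function space `𝒮 = 𝒮(ℝ^d, ℂ^N)`. -/
abbrev TestFun (d N : ℕ) : Type := 𝓢(Spacetime d, EuclideanSpace ℂ (Fin N))

/-- `n`-point configurations `(x_1, …, x_n) ∈ (ℝ^d)^n`. -/
abbrev Config (d n : ℕ) : Type := PiLp 2 (fun _ : Fin n => Spacetime d)

/-- The coefficient space `(ℂ^N)^{⊗ n}`; a tensor is given by its components, which are indexed by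
multi-indices `α = (α_1, …, α_n)`. -/
abbrev Coeff (N n : ℕ) : Type := EuclideanSpace ℂ (Fin n → Fin N)

/-- The (completed) `n`-fold tensor power of `𝒮`, i.e. `𝒮((ℝ^d)^n, (ℂ^N)^{⊗ n})`. -/
abbrev TensorTestFun (d N n : ℕ) : Type := 𝓢(Config d n, Coeff N n)

section Outer

variable {E E₁ E₂ F₁ F₂ G : Type*}
  [NormedAddCommGroup E] [NormedSpace ℝ E]
  [NormedAddCommGroup E₁] [NormedSpace ℝ E₁] [NormedAddCommGroup E₂] [NormedSpace ℝ E₂]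
  [NormedAddCommGroup F₁] [NormedSpace ℝ F₁] [NormedAddCommGroup F₂] [NormedSpace ℝ F₂]
  [NormedAddCommGroup G] [NormedSpace ℝ G]

theorem norm_iteratedFDeriv_comp_le (P : E →L[ℝ] E₁) (f : 𝓢(E₁, F₁)) (j : ℕ) (x : E) :
    ‖iteratedFDeriv ℝ j (fun y => f (P y)) x‖ ≤ ‖iteratedFDeriv ℝ j f (P x)‖ * ‖P‖ ^ j := by
  have h := P.iteratedFDeriv_comp_right (f.smooth ⊤) x (i := j) (mod_cast le_top)
  change ‖iteratedFDeriv ℝ j (f ∘ P) x‖ ≤ _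
  rw [h]
  refine (ContinuousMultilinearMap.norm_compContinuousLinearMap_le _ _).trans ?_
  simp

variable [FiniteDimensional ℝ E]

theorem exists_norm_le_of_ker (P : E →L[ℝ] E₁) (Q : E →L[ℝ] E₂)
    (hPQ : ∀ x, P x = 0 → Q x = 0 → x = 0) :
    ∃ K : ℝ, 0 ≤ K ∧ ∀ x, ‖x‖ ≤ K * max ‖P x‖ ‖Q x‖ := by
  have hker : LinearMap.ker ((P.prod Q : E →L[ℝ] E₁ × E₂) : E →ₗ[ℝ] E₁ × E₂) = ⊥ := by
    rw [LinearMap.ker_eq_bot']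
    intro x hx
    have hx' : (P x, Q x) = 0 := hx
    exact hPQ x (congrArg Prod.fst hx') (congrArg Prod.snd hx')
  obtain ⟨K, -, hK⟩ := LinearMap.exists_antilipschitzWith _ hker
  refine ⟨K, K.2, fun x => ?_⟩
  have := hK.le_mul_dist x 0
  simpa [dist_eq_norm, Prod.norm_def] using this

/-- The Schwartz function `x ↦ B (f (P x)) (h (Q x))`, where `P, Q` are linear maps that jointly
separate points and `B` is bilinear. -/
def outer (P : E →L[ℝ] E₁) (Q : E →L[ℝ] E₂) (hPQ : ∀ x, P x = 0 → Q x = 0 → x = 0)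
    (B : F₁ →L[ℝ] F₂ →L[ℝ] G) (f : 𝓢(E₁, F₁)) (h : 𝓢(E₂, F₂)) : 𝓢(E, G) where
  toFun x := B (f (P x)) (h (Q x))
  smooth' := (B.isBoundedBilinearMap.contDiff).comp₂
    ((f.smooth ⊤).comp P.contDiff) ((h.smooth ⊤).comp Q.contDiff)
  decay' k n := by
    obtain ⟨K, hK0, hK⟩ := exists_norm_le_of_ker P Q hPQ
    choose Cf hCf using f.decay
    choose Ch hCh using h.decay
    refine ⟨‖B‖ * ∑ i ∈ Finset.range (n + 1), K ^ k * (n.choose i * (‖P‖ ^ i * ‖Q‖ ^ (n - i) *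
      (Cf k i * Ch 0 (n - i) + Cf 0 i * Ch k (n - i)))), fun x => ?_⟩
    have hb := B.norm_iteratedFDeriv_le_of_bilinear (N := ∞)
      (f := fun x => f (P x)) (g := fun x => h (Q x))
      ((f.smooth ⊤).comp P.contDiff) ((h.smooth ⊤).comp Q.contDiff) x (n := n) (mod_cast le_top)
    refine (mul_le_mul_of_nonneg_left hb (by positivity)).trans ?_
    rw [mul_left_comm, Finset.mul_sum]
    refine mul_le_mul_of_nonneg_left (Finset.sum_le_sum fun i _ => ?_) B.opNorm_nonneg
    set a := ‖iteratedFDeriv ℝ i f (P x)‖ with ha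
    set b := ‖iteratedFDeriv ℝ (n - i) h (Q x)‖ with hb'
    have ha0 : 0 ≤ a := norm_nonneg _
    have hb0 : 0 ≤ b := norm_nonneg _
    have h1 := norm_iteratedFDeriv_comp_le P f i x
    have h2 := norm_iteratedFDeriv_comp_le Q h (n - i) x
    have hx : ‖x‖ ^ k ≤ K ^ k * (‖P x‖ ^ k + ‖Q x‖ ^ k) := by
      refine (pow_le_pow_left₀ (norm_nonneg _) (hK x) k).trans ?_
      rw [mul_pow]
      refine mul_le_mul_of_nonneg_left ?_ (by positivity)
      rcases max_choice ‖P x‖ ‖Q x‖ with e | e <;> rw [e]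
      · exact le_add_of_nonneg_right (by positivity)
      · exact le_add_of_nonneg_left (by positivity)
    have f1 : ‖P x‖ ^ k * a ≤ Cf k i := (hCf k i).2 (P x)
    have f0 : a ≤ Cf 0 i := by simpa using (hCf 0 i).2 (P x)
    have g1 : ‖Q x‖ ^ k * b ≤ Ch k (n - i) := (hCh k (n - i)).2 (Q x)
    have g0 : b ≤ Ch 0 (n - i) := by simpa using (hCh 0 (n - i)).2 (Q x)
    calc ‖x‖ ^ k * (n.choose i * ‖iteratedFDeriv ℝ i (fun x => f (P x)) x‖ *
          ‖iteratedFDeriv ℝ (n - i) (fun x => h (Q x)) x‖)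
        ≤ (K ^ k * (‖P x‖ ^ k + ‖Q x‖ ^ k)) *
          (n.choose i * (a * ‖P‖ ^ i) * (b * ‖Q‖ ^ (n - i))) := by gcongr
      _ = K ^ k * (n.choose i * (‖P‖ ^ i * ‖Q‖ ^ (n - i) *
          ((‖P x‖ ^ k * a) * b + a * (‖Q x‖ ^ k * b)))) := by ring
      _ ≤ _ := by
        have : 0 ≤ Cf k i := le_trans (by positivity) f1
        have : 0 ≤ Cf 0 i := le_trans (by positivity) f0
        gcongr

@[simp]
theorem outer_apply (P : E →L[ℝ] E₁) (Q : E →L[ℝ] E₂) (hPQ : ∀ x, P x = 0 → Q x = 0 → x = 0)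
    (B : F₁ →L[ℝ] F₂ →L[ℝ] G) (f : 𝓢(E₁, F₁)) (h : 𝓢(E₂, F₂)) (x : E) :
    outer P Q hPQ B f h x = B (f (P x)) (h (Q x)) := rfl

end Outer

/-- Restriction of a configuration along a map of labels. -/
def Config.pull (d : ℕ) {n k : ℕ} (e : Fin k → Fin n) : Config d n →L[ℝ] Config d k :=
  ((PiLp.continuousLinearEquiv 2 ℝ (fun _ : Fin k => Spacetime d)).symm :
      (Fin k → Spacetime d) →L[ℝ] Config d k).comp
    (ContinuousLinearMap.pi fun i =>
      (PiLp.proj 2 (fun _ : Fin n => Spacetime d) (e i) : Config d n →L[ℝ] Spacetime d))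

@[simp]
theorem Config.pull_apply (d : ℕ) {n k : ℕ} (e : Fin k → Fin n) (x : Config d n) (i : Fin k) :
    Config.pull d e x i = x (e i) := rfl

/-- For maps `a, b` of index sets: the bilinear map sending `u, v` to the vector with components `u (a α) * v (b α)`. -/
def mulComponents {ι κ μ : Type} [Fintype ι] [Fintype κ] [Fintype μ] (a : μ → ι) (b : μ → κ) :
    EuclideanSpace ℂ ι →L[ℝ] EuclideanSpace ℂ κ →L[ℝ] EuclideanSpace ℂ μ :=
  (LinearMap.mk₂ ℝ
    (fun (u : EuclideanSpace ℂ ι) (v : EuclideanSpace ℂ κ) =>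
      (WithLp.toLp 2 fun α => u (a α) * v (b α) : EuclideanSpace ℂ μ))
    (fun u u' v => by ext α; simp [add_mul])
    (fun c u v => by ext α; simp [mul_assoc])
    (fun u v v' => by ext α; simp [mul_add])
    (fun c u v => by ext α; simp [mul_left_comm])).toContinuousBilinearMap

@[simp]
theorem mulComponents_apply {ι κ μ : Type} [Fintype ι] [Fintype κ] [Fintype μ]
    (a : μ → ι) (b : μ → κ) (u : EuclideanSpace ℂ ι) (v : EuclideanSpace ℂ κ) (α : μ) :
    mulComponents a b u v α = u (a α) * v (b α) := rfl

/-- The tensor product `f ⊗ h` of `f ∈ 𝒮^{⊗ n}` and `h ∈ 𝒮^{⊗ m}`. -/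
def tensor {d N n m : ℕ} (f : TensorTestFun d N n) (h : TensorTestFun d N m) :
    TensorTestFun d N (n + m) :=
  outer (Config.pull d (Fin.castAdd m)) (Config.pull d (Fin.natAdd n))
    (fun x h₁ h₂ => by
      ext1 i
      refine Fin.addCases (fun j => ?_) (fun j => ?_) i
      · exact congrArg (fun y : Config d n => y j) h₁
      · exact congrArg (fun y : Config d m => y j) h₂)
    (mulComponents (fun α i => α (Fin.castAdd m i)) (fun α i => α (Fin.natAdd n i))) f h

theorem tensor_apply {d N n m : ℕ} (f : TensorTestFun d N n) (h : TensorTestFun d N m)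
    (x : Config d (n + m)) (α : Fin (n + m) → Fin N) :
    tensor f h x α =
      f (WithLp.toLp 2 fun i => x (Fin.castAdd m i)) (fun i => α (Fin.castAdd m i)) *
      h (WithLp.toLp 2 fun i => x (Fin.natAdd n i)) (fun i => α (Fin.natAdd n i)) := rfl

/-- The product test function `f_1 ⊗ ⋯ ⊗ f_n` of `f_1, …, f_n ∈ 𝒮`; see `tensorProd_apply` for its
values. -/
def tensorProd {d N : ℕ} : {n : ℕ} → (Fin n → TestFun d N) → TensorTestFun d N n
  | 0, _ => HasCompactSupport.toSchwartzMap
      (f := fun _ : Config d 0 => (WithLp.toLp 2 fun _ => 1 : Coeff N 0))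
      (HasCompactSupport.of_compactSpace _) contDiff_const
  | n + 1, f =>
      outer (Config.pull d (Fin.castSucc (n := n)))
        (PiLp.proj 2 (fun _ : Fin (n + 1) => Spacetime d) (Fin.last n) :
          Config d (n + 1) →L[ℝ] Spacetime d)
        (fun x h₁ h₂ => by
          ext1 i
          refine Fin.lastCases ?_ (fun j => ?_) i
          · exact h₂
          · exact congrArg (fun y : Config d n => y j) h₁)
        (mulComponents (fun α i => α (Fin.castSucc i)) (fun α => α (Fin.last n)))
        (tensorProd fun i => f i.castSucc) (f (Fin.last n))

theorem tensorProd_apply {d N : ℕ} : ∀ {n : ℕ} (f : Fin n → TestFun d N) (x : Config d n)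
    (α : Fin n → Fin N), tensorProd f x α = ∏ i, f i (x i) (α i)
  | 0, _, _, _ => by simp [tensorProd]
  | n + 1, f, x, α => by
      rw [Fin.prod_univ_castSucc, tensorProd, outer_apply, mulComponents_apply, tensorProd_apply]
      rfl

/-- A Schwartz norm: a norm on `𝒮` that is continuous for the Schwartz topology. -/
structure IsSchwartzNorm {d N : ℕ} (p : Seminorm ℂ (TestFun d N)) : Prop where
  continuous : Continuous p
  definite : ∀ f, p f = 0 → f = 0

/-- The algebraic tensor power of `𝒮`, realized as a subspace of `𝒮((ℝ^d)^n, (ℂ^N)^{⊗ n})`. -/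
def algTensor (d N n : ℕ) : Submodule ℂ (TensorTestFun d N n) :=
  Submodule.span ℂ (Set.range (tensorProd (d := d) (N := N) (n := n)))

/-- The tensor norm `‖·‖^{⊗ n}` (projective, i.e. the largest cross norm) on the algebraic tensor
power: the infimum of `∑_j |c_j| ‖f_{j,1}‖ ⋯ ‖f_{j,n}‖` over all finite representations
`F = ∑_j c_j f_{j,1} ⊗ ⋯ ⊗ f_{j,n}`. It is only used for `F` in `algTensor d N n`, for which such
representations exist. -/
def tensorNorm {d N : ℕ} (p : Seminorm ℂ (TestFun d N)) {n : ℕ} (F : TensorTestFun d N n) : ℝ :=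
  sInf {r : ℝ | ∃ (k : ℕ) (c : Fin k → ℂ) (f : Fin k → Fin n → TestFun d N),
    F = ∑ j, c j • tensorProd (f j) ∧ r = ∑ j, ‖c j‖ * ∏ i, p (f j i)}

/-- Continuity of a linear functional with respect to `‖·‖^{⊗ n}`. -/
def ContinuousForTensorNorm {d N n : ℕ} (p : Seminorm ℂ (TestFun d N))
    (T : TensorTestFun d N n →L[ℂ] ℂ) : Prop :=
  ∃ C : ℝ, ∀ F ∈ algTensor d N n, ‖T F‖ ≤ C * tensorNorm p F

/-- `WT` is the sequence of truncated functions of `W`: for `n ≥ 1`,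
`W_n (f_1 ⊗ ⋯ ⊗ f_n) = ∑_I ∏_{{j_1 < ⋯ < j_l} ∈ I} WT_l (f_{j_1} ⊗ ⋯ ⊗ f_{j_l})`, the sum being over
all partitions `I` of the index set into nonempty blocks. The value `WT 0` plays no role. -/
def IsTruncationOf {d N : ℕ} (WT W : ∀ n, TensorTestFun d N n →L[ℂ] ℂ) : Prop :=
  ∀ n, 1 ≤ n → ∀ f : Fin n → TestFun d N,
    W n (tensorProd f) =
      ∑ I : Finpartition (Finset.univ : Finset (Fin n)),
        ∏ b ∈ I.parts, WT b.card (tensorProd fun i => f (b.orderEmbOfFin rfl i))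

/-- A Hilbert seminorm: a continuous seminorm induced by a positive semidefinite Hermitian
sesquilinear form. -/
structure IsHilbertSeminorm {V : Type*} [AddCommGroup V] [Module ℂ V] [TopologicalSpace V]
    (p : Seminorm ℂ V) : Prop where
  continuous : Continuous p
  exists_inner : ∃ c : PreInnerProductSpace.Core ℂ V, ∀ f, p f ^ 2 = (c.inner f f).re

/-- The Hilbert space structure condition. -/
def HilbertSpaceStructureCondition {d N : ℕ} (W : ∀ n, TensorTestFun d N n →L[ℂ] ℂ) : Prop :=
  ∃ p : ∀ n, Seminorm ℂ (TensorTestFun d N n), (∀ n, IsHilbertSeminorm (p n)) ∧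
    ∀ (n m : ℕ) (f : TensorTestFun d N n) (h : TensorTestFun d N m),
      ‖W (n + m) (tensor f h)‖ ≤ p n f * p m h

end Wightman

end

noncomputable section

namespace Wightman

open Filter Topology FourierTransform MeasureTheory

section Seminorms

variable {E F : Type*} [NormedAddCommGroup E] [NormedSpace ℝ E]
  [NormedAddCommGroup F] [NormedSpace ℝ F]

/-- A pointwise convergent series of Schwartz functions that is absolutely summable for every
Schwartz seminorm converges in the Schwartz space. -/
theorem hasSum_schwartz_of_pointwise {A : Type*} {g : A → 𝓢(E, F)} {f : 𝓢(E, F)} [CompleteSpace F]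
    (hg : ∀ k l : ℕ, Summable fun a => SchwartzMap.seminorm ℝ k l (g a))
    (hf : ∀ x, HasSum (fun a => g a x) (f x)) : HasSum g f := by
  have hder : ∀ (l : ℕ) (x : E),
      iteratedFDeriv ℝ l f x = ∑' a, iteratedFDeriv ℝ l (g a) x := by
    intro l x
    have hfun : (f : E → F) = fun x => ∑' a, g a x := funext fun x => (hf x).tsum_eq.symm
    rw [hfun]
    exact iteratedFDeriv_tsum_apply (N := ⊤) (v := fun l a => SchwartzMap.seminorm ℝ 0 l (g a))
      (fun a => (g a).smooth ⊤) (fun l _ => hg 0 l)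
      (fun l a x _ => by simpa using (g a).le_seminorm ℝ 0 l x) le_top x
  have hsum : ∀ (l : ℕ) (x : E), Summable fun a => iteratedFDeriv ℝ l (g a) x := fun l x =>
    Summable.of_norm_bounded (hg 0 l) fun a => by simpa using (g a).le_seminorm ℝ 0 l x
  refine ((schwartz_withSeminorms ℝ E F).tendsto_nhds _ _).2 ?_
  rintro ⟨k, l⟩ ε hε
  have htail := tendsto_tsum_compl_atTop_zero fun a => SchwartzMap.seminorm ℝ k l (g a)
  filter_upwards [htail.eventually (gt_mem_nhds hε)] with s hs
  refine lt_of_le_of_lt ?_ hs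
  rw [map_sub_rev]
  have hsub : Summable fun a : {a // a ∉ s} => SchwartzMap.seminorm ℝ k l (g a) :=
    (hg k l).subtype _
  refine SchwartzMap.seminorm_le_bound ℝ k l _ (tsum_nonneg fun a => apply_nonneg _ _) fun x => ?_
  have hx : iteratedFDeriv ℝ l (f - ∑ a ∈ s, g a : 𝓢(E, F)) x
      = ∑' a : {a // a ∉ s}, iteratedFDeriv ℝ l (g a) x := by
    have h1 : ((f - ∑ a ∈ s, g a : 𝓢(E, F)) : E → F) = (f : E → F) - fun x => ∑ a ∈ s, g a x := by
      ext x; simp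
    rw [h1, iteratedFDeriv_sub_apply (f.contDiffAt l)
      (ContDiffAt.sum fun a _ => (g a).contDiffAt l),
      iteratedFDeriv_sum fun a _ => (g a).smooth l, Finset.sum_apply, hder,
      ← (hsum l x).sum_add_tsum_subtype_compl s, add_sub_cancel_left]
  have hle : ∀ a : {a // a ∉ s}, ‖‖x‖ ^ k • iteratedFDeriv ℝ l (g a) x‖
      ≤ SchwartzMap.seminorm ℝ k l (g a) := fun a => by
    rw [norm_smul, norm_pow, norm_norm]
    exact (g a).le_seminorm ℝ k l x
  calc ‖x‖ ^ k * ‖iteratedFDeriv ℝ l (f - ∑ a ∈ s, g a : 𝓢(E, F)) x‖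
      = ‖∑' a : {a // a ∉ s}, ‖x‖ ^ k • iteratedFDeriv ℝ l (g a) x‖ := by
        rw [hx, tsum_const_smul'', norm_smul, norm_pow, norm_norm]
    _ ≤ _ := tsum_of_norm_bounded hsub.hasSum hle

variable {E' F' : Type*} [NormedAddCommGroup E'] [NormedSpace ℝ E'] [NormedAddCommGroup F']
  [NormedSpace ℝ F'] [NormedSpace ℂ F] [SMulCommClass ℝ ℂ F] [NormedSpace ℂ F']
  [SMulCommClass ℝ ℂ F']

theorem continuous_schwartz_seminorm (k l : ℕ) :
    Continuous (SchwartzMap.seminorm ℂ k l : Seminorm ℂ 𝓢(E, F)) :=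
  (schwartz_withSeminorms ℂ E F).continuous_seminorm (k, l)

/-- The increasing family of seminorms `max_{(k,l) ≤ m} ‖·‖_{k,l}`. -/
def supSeminorm (E F : Type*) [NormedAddCommGroup E] [NormedSpace ℝ E]
    [NormedAddCommGroup F] [NormedSpace ℝ F] [NormedSpace ℂ F] [SMulCommClass ℝ ℂ F] (m : ℕ × ℕ) :
    Seminorm ℂ 𝓢(E, F) :=
  (Finset.Iic m).sup fun m => SchwartzMap.seminorm ℂ m.1 m.2

theorem continuous_supSeminorm (m : ℕ × ℕ) : Continuous (supSeminorm E F m) :=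
  Seminorm.continuous_finsetSup fun i _ => continuous_schwartz_seminorm i.1 i.2

theorem one_add_pow_mul_le_supSeminorm {k l j : ℕ} (hj : j ≤ l) (f : 𝓢(E, F)) (x : E) :
    (1 + ‖x‖) ^ k * ‖iteratedFDeriv ℝ j f x‖ ≤ 2 ^ k * supSeminorm E F (k, l) f :=
  SchwartzMap.one_add_le_sup_seminorm_apply (m := (k, l)) le_rfl hj f x

/-- Estimates for finitely many Schwartz seminorms of a family of maps combine into an estimate
for any seminorm these dominate. -/
theorem exists_seminorm_bound {T : Type*} (A : T → 𝓢(E, F) → 𝓢(E', F')) {w : T → ℝ}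
    (hw : ∀ t, 0 ≤ w t) (q : Seminorm ℂ 𝓢(E', F')) (S : Finset (ℕ × ℕ)) (C : NNReal)
    (hq : q ≤ C • S.sup (schwartzSeminormFamily ℂ E' F'))
    (h : ∀ i ∈ S, ∃ s : Seminorm ℂ 𝓢(E, F), Continuous s ∧
      ∀ t f, SchwartzMap.seminorm ℂ i.1 i.2 (A t f) ≤ w t * s f) :
    ∃ s : Seminorm ℂ 𝓢(E, F), Continuous s ∧ ∀ t f, q (A t f) ≤ w t * s f := by
  choose! s hs hb using h
  refine ⟨C • S.sup s, (Seminorm.continuous_finsetSup hs).const_smul C, fun t f => ?_⟩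
  calc q (A t f) ≤ C * S.sup (schwartzSeminormFamily ℂ E' F') (A t f) := hq _
    _ ≤ C * (w t * S.sup s f) := by
        gcongr
        refine Seminorm.finset_sup_apply_le (mul_nonneg (hw t) (apply_nonneg _ _)) fun i hi => ?_
        refine (hb i hi t f).trans (mul_le_mul_of_nonneg_left ?_ (hw t))
        exact Finset.le_sup (f := s) hi f
    _ = w t * (C • S.sup s) f := by
        rw [smul_apply, NNReal.smul_def, smul_eq_mul]; ring

/-- Translations act on the Schwartz space with polynomial growth. -/
theorem exists_translation_bound (q : Seminorm ℂ 𝓢(E, F)) (hq : Continuous q) :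
    ∃ (M : ℕ) (s : Seminorm ℂ 𝓢(E, F)), Continuous s ∧
      ∀ y f, q (SchwartzMap.compSubConstCLM ℂ y f) ≤ (1 + ‖y‖) ^ M * s f := by
  obtain ⟨S, C, -, hS⟩ := Seminorm.bound_of_continuous (schwartz_withSeminorms ℂ E F) q hq
  refine ⟨S.sup Prod.fst, exists_seminorm_bound (fun y f => SchwartzMap.compSubConstCLM ℂ y f)
    (fun y => by positivity) q S C hS ?_⟩
  rintro ⟨k, l⟩ hi
  refine ⟨(2 ^ k : NNReal) • supSeminorm E F (k, l), (continuous_supSeminorm _).const_smul _,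
    fun y f => SchwartzMap.seminorm_le_bound ℂ _ _ _
      (mul_nonneg (by positivity) (apply_nonneg _ _)) fun x => ?_⟩
  have hxy : ‖x‖ ≤ (1 + ‖y‖) * (1 + ‖x - y‖) := by
    have := norm_le_norm_add_norm_sub y x
    nlinarith [norm_nonneg y, norm_nonneg (x - y), norm_sub_rev x y]
  have hk : k ≤ S.sup Prod.fst := Finset.le_sup (f := Prod.fst) hi
  have hD : iteratedFDeriv ℝ l (SchwartzMap.compSubConstCLM ℂ y f) x
      = iteratedFDeriv ℝ l f (x - y) := iteratedFDeriv_comp_sub l y x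
  rw [hD, smul_apply, NNReal.smul_def, smul_eq_mul]
  calc ‖x‖ ^ k * ‖iteratedFDeriv ℝ l f (x - y)‖
      ≤ ((1 + ‖y‖) * (1 + ‖x - y‖)) ^ k * ‖iteratedFDeriv ℝ l f (x - y)‖ := by gcongr
    _ = (1 + ‖y‖) ^ k * ((1 + ‖x - y‖) ^ k * ‖iteratedFDeriv ℝ l f (x - y)‖) := by
        rw [mul_pow, mul_assoc]
    _ ≤ (1 + ‖y‖) ^ (S.sup Prod.fst) * (2 ^ k * supSeminorm E F (k, l) f) :=
        mul_le_mul (pow_le_pow_right₀ (by linarith [norm_nonneg y]) hk)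
          (one_add_pow_mul_le_supSeminorm le_rfl f _) (by positivity) (by positivity)

/-- Multiplication by a translated Schwartz function decays rapidly in the translation. -/
theorem exists_mul_translate_bound (θ : 𝓢(E, ℂ)) (M : ℕ) (q : Seminorm ℂ 𝓢(E, ℂ))
    (hq : Continuous q) :
    ∃ s : Seminorm ℂ 𝓢(E, ℂ), Continuous s ∧ ∀ y f,
      q (SchwartzMap.smulLeftCLM ℂ (SchwartzMap.compSubConstCLM ℂ y θ) f)
        ≤ ((1 + ‖y‖) ^ M)⁻¹ * s f := by
  obtain ⟨S, C, -, hS⟩ := Seminorm.bound_of_continuous (schwartz_withSeminorms ℂ E ℂ) q hq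
  refine exists_seminorm_bound
    (fun y f => SchwartzMap.smulLeftCLM ℂ (SchwartzMap.compSubConstCLM ℂ y θ) f)
    (fun y => by positivity) q S C hS ?_
  rintro ⟨k, l⟩ -
  let c : NNReal := ∑ i ∈ Finset.range (l + 1),
    (l.choose i : NNReal) * (2 ^ M * (supSeminorm E ℂ (M, i) θ).toNNReal) * 2 ^ (M + k)
  refine ⟨c • supSeminorm E ℂ (M + k, l), (continuous_supSeminorm _).const_smul _, fun y f =>
    SchwartzMap.seminorm_le_bound ℂ _ _ _ (mul_nonneg (by positivity) (apply_nonneg _ _))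
      fun x => ?_⟩
  have hxy : 1 + ‖y‖ ≤ (1 + ‖x - y‖) * (1 + ‖x‖) := by
    have := norm_le_norm_add_norm_sub x y
    nlinarith [norm_nonneg x, norm_nonneg (x - y), norm_sub_rev x y]
  have hcoe : (SchwartzMap.smulLeftCLM ℂ (SchwartzMap.compSubConstCLM ℂ y θ) f : E → ℂ)
      = fun x => SchwartzMap.compSubConstCLM ℂ y θ x • f x :=
    SchwartzMap.smulLeftCLM_apply (SchwartzMap.hasTemperateGrowth _) f
  rw [hcoe, le_inv_mul_iff₀ (by positivity), smul_apply, NNReal.smul_def, smul_eq_mul]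
  have hL := norm_iteratedFDeriv_smul_le (𝕜 := ℝ) (N := ∞)
    ((SchwartzMap.compSubConstCLM ℂ y θ).smooth ⊤) (f.smooth ⊤) x (n := l) (mod_cast le_top)
  refine (mul_le_mul_of_nonneg_left (mul_le_mul_of_nonneg_left hL (by positivity))
    (by positivity)).trans ?_
  simp only [c, NNReal.coe_sum, Finset.sum_mul, Finset.mul_sum]
  refine Finset.sum_le_sum fun i _ => ?_
  have hD : iteratedFDeriv ℝ i (SchwartzMap.compSubConstCLM ℂ y θ) x
      = iteratedFDeriv ℝ i θ (x - y) := iteratedFDeriv_comp_sub i y x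
  rw [hD]
  have h1 := one_add_pow_mul_le_supSeminorm (k := M) (le_refl i) θ (x - y)
  have h2 := one_add_pow_mul_le_supSeminorm (k := M + k) (Nat.sub_le l i) f x
  set a := ‖iteratedFDeriv ℝ i θ (x - y)‖
  set b := ‖iteratedFDeriv ℝ (l - i) f x‖
  calc (1 + ‖y‖) ^ M * (‖x‖ ^ k * (l.choose i * a * b))
      ≤ ((1 + ‖x - y‖) * (1 + ‖x‖)) ^ M * ((1 + ‖x‖) ^ k * (l.choose i * a * b)) := by
        gcongr
        linarith [norm_nonneg x]
    _ = l.choose i * ((1 + ‖x - y‖) ^ M * a) * ((1 + ‖x‖) ^ (M + k) * b) := by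
        rw [mul_pow, pow_add]; ring
    _ ≤ l.choose i * (2 ^ M * supSeminorm E ℂ (M, i) θ) *
          (2 ^ (M + k) * supSeminorm E ℂ (M + k, l) f) := by
        refine mul_le_mul (mul_le_mul_of_nonneg_left h1 (by positivity)) h2 (by positivity) ?_
        exact mul_nonneg (by positivity) (mul_nonneg (by positivity) (apply_nonneg _ _))
    _ = _ := by
        push_cast [Real.coe_toNNReal _ (apply_nonneg (supSeminorm E ℂ (M, i)) θ)]
        ring

end Seminorms

section TimeFrequency

variable {V : Type*} [NormedAddCommGroup V] [InnerProductSpace ℝ V] [FiniteDimensional ℝ V]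
  [MeasurableSpace V] [BorelSpace V]

/-- The time-frequency shift `x ↦ e^{2πi⟨ξ, x⟩} u (x - y)` of `u`. -/
def timeFreqShift (y ξ : V) (u : 𝓢(V, ℂ)) : 𝓢(V, ℂ) :=
  𝓕⁻ (SchwartzMap.compSubConstCLM ℂ ξ (𝓕 (SchwartzMap.compSubConstCLM ℂ y u)))

theorem fourierInv_compSubConst (ξ : V) (v : 𝓢(V, ℂ)) (x : V) :
    𝓕⁻ (SchwartzMap.compSubConstCLM ℂ ξ v) x = Real.fourierChar (inner ℝ ξ x) * 𝓕⁻ v x := by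
  rw [SchwartzMap.fourierInv_coe, SchwartzMap.fourierInv_coe, Real.fourierInv_eq,
    Real.fourierInv_eq, ← integral_const_mul,
    ← integral_sub_right_eq_self (fun w => _ * (Real.fourierChar (inner ℝ w x) • v w)) ξ]
  refine integral_congr_ae (.of_forall fun w => ?_)
  simp only [SchwartzMap.compSubConstCLM_apply, Circle.smul_def, smul_eq_mul, ← mul_assoc,
    ← Circle.coe_mul, ← AddChar.map_add_eq_mul, inner_sub_left, add_sub_cancel]

theorem timeFreqShift_apply (y ξ : V) (u : 𝓢(V, ℂ)) (x : V) :
    timeFreqShift y ξ u x = Real.fourierChar (inner ℝ ξ x) * u (x - y) := by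
  rw [timeFreqShift, fourierInv_compSubConst, FourierTransform.fourierInv_fourier_eq]
  rfl

/-- Time-frequency shifts act with polynomial growth. -/
theorem exists_timeFreqShift_bound (q : Seminorm ℂ 𝓢(V, ℂ)) (hq : Continuous q) (u : 𝓢(V, ℂ)) :
    ∃ (M : ℕ) (C : ℝ), 0 ≤ C ∧
      ∀ y ξ, q (timeFreqShift y ξ u) ≤ C * ((1 + ‖y‖) ^ M * (1 + ‖ξ‖) ^ M) := by
  obtain ⟨M₁, s₁, hs₁, h₁⟩ := exists_translation_bound
    (q.comp (fourierInvCLM ℂ 𝓢(V, ℂ)).toLinearMap)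
    (hq.comp (fourierInvCLM ℂ 𝓢(V, ℂ)).continuous)
  obtain ⟨M₂, s₂, hs₂, h₂⟩ := exists_translation_bound
    (s₁.comp (fourierCLM ℂ 𝓢(V, ℂ)).toLinearMap) (hs₁.comp (fourierCLM ℂ 𝓢(V, ℂ)).continuous)
  refine ⟨M₁ + M₂, s₂ u, apply_nonneg _ _, fun y ξ => ?_⟩
  have e₁ := h₁ ξ (𝓕 (SchwartzMap.compSubConstCLM ℂ y u))
  have e₂ := h₂ y u
  have hy : (1 : ℝ) ≤ 1 + ‖y‖ := by linarith [norm_nonneg y]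
  have hξ : (1 : ℝ) ≤ 1 + ‖ξ‖ := by linarith [norm_nonneg ξ]
  calc q (timeFreqShift y ξ u) ≤ (1 + ‖ξ‖) ^ M₁ * ((1 + ‖y‖) ^ M₂ * s₂ u) :=
        e₁.trans (mul_le_mul_of_nonneg_left e₂ (by positivity))
    _ ≤ (1 + ‖ξ‖) ^ (M₁ + M₂) * ((1 + ‖y‖) ^ (M₁ + M₂) * s₂ u) := by
        gcongr <;> first | assumption | omega
    _ = _ := by ring

/-- The short-time Fourier transform `∫ θ(x - y) f(x) e^{-2πi⟨ξ, x⟩} dx`. -/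
def shortTimeFourier (θ : 𝓢(V, ℂ)) (y ξ : V) : 𝓢(V, ℂ) →ₗ[ℂ] ℂ where
  toFun f := 𝓕 (SchwartzMap.smulLeftCLM ℂ (SchwartzMap.compSubConstCLM ℂ y θ) f) ξ
  map_add' f g := by rw [map_add, FourierTransform.fourier_add]; rfl
  map_smul' c f := by rw [map_smul, FourierTransform.fourier_smul]; rfl

/-- The short-time Fourier transform decays rapidly. -/
theorem exists_shortTimeFourier_bound (θ : 𝓢(V, ℂ)) (M : ℕ) :
    ∃ s : Seminorm ℂ 𝓢(V, ℂ), Continuous s ∧ ∀ y ξ f,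
      ‖shortTimeFourier θ y ξ f‖ ≤ ((1 + ‖y‖) ^ M * (1 + ‖ξ‖) ^ M)⁻¹ * s f := by
  obtain ⟨s, hs, h⟩ := exists_mul_translate_bound θ M
    ((supSeminorm V ℂ (M, 0)).comp (fourierCLM ℂ 𝓢(V, ℂ)).toLinearMap)
    ((continuous_supSeminorm _).comp (fourierCLM ℂ 𝓢(V, ℂ)).continuous)
  refine ⟨(2 ^ M : NNReal) • s, hs.const_smul _, fun y ξ f => ?_⟩
  have e := one_add_pow_mul_le_supSeminorm (k := M) (le_refl 0)
    (𝓕 (SchwartzMap.smulLeftCLM ℂ (SchwartzMap.compSubConstCLM ℂ y θ) f)) ξ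
  rw [norm_iteratedFDeriv_zero] at e
  have e' := h y f
  rw [mul_inv, smul_apply, NNReal.smul_def, smul_eq_mul,
    mul_comm (((1 + ‖y‖) ^ M)⁻¹), mul_assoc, le_inv_mul_iff₀ (by positivity), mul_left_comm]
  exact e.trans (mul_le_mul_of_nonneg_left e' (by positivity))

end TimeFrequency

section Torus

variable {κ : Type*}

/-- The lift to the torus of a function on the cube of side `1` centred at `a`. -/
def torusLift (a : κ → ℝ) (h : (κ → ℝ) → ℂ) (t : UnitAddTorus κ) : ℂ :=
  h fun i => (AddCircle.equivIoc 1 (a i - 1 / 2) (t i) : ℝ)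

theorem torusLift_coe {a : κ → ℝ} (h : (κ → ℝ) → ℂ) {z : κ → ℝ}
    (hz : ∀ i, z i ∈ Set.Ioc (a i - 1 / 2) (a i - 1 / 2 + 1)) :
    torusLift a h (fun i => (z i : UnitAddCircle)) = h z := by
  unfold torusLift
  congr 1
  ext i
  rw [AddCircle.equivIoc_coe_eq (hz i)]

theorem norm_sub_coe_eq_abs_equivIoc (c : ℝ) (t : UnitAddCircle) :
    ‖t - (c : UnitAddCircle)‖ = |(AddCircle.equivIoc 1 (c - 1 / 2) t : ℝ) - c| := by
  set r := AddCircle.equivIoc (1 : ℝ) (c - 1 / 2) t with hr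
  have hcoe : ((r : ℝ) : UnitAddCircle) = t := (AddCircle.equivIoc 1 (c - 1 / 2)).symm_apply_apply t
  have hmem := r.2
  rw [← hcoe, ← AddCircle.coe_sub, AddCircle.norm_coe_eq_abs_iff _ one_ne_zero, abs_le]
  simp only [abs_one]
  constructor <;> linarith [hmem.1, hmem.2]

variable [Fintype κ]

theorem continuous_torusLift {a : κ → ℝ} {h : (κ → ℝ) → ℂ} (hc : Continuous h)
    (h0 : ∀ z, (∃ i, 1 / 4 ≤ |z i - a i|) → h z = 0) : Continuous (torusLift a h) := by
  rw [continuous_iff_continuousAt]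
  intro t
  by_cases ht : ∃ i, t i = ((a i - 1 / 2 : ℝ) : UnitAddCircle)
  · obtain ⟨i, hi⟩ := ht
    have hn : 1 / 4 < ‖t i - (a i : UnitAddCircle)‖ := by
      rw [hi, ← AddCircle.coe_sub, (AddCircle.norm_coe_eq_abs_iff _ one_ne_zero).2] <;>
        simp <;> norm_num
    have hev : ∀ᶠ s in 𝓝 t, torusLift a h s = 0 := by
      have hcont : Continuous fun s : UnitAddTorus κ => ‖s i - (a i : UnitAddCircle)‖ := by fun_prop
      filter_upwards [hcont.continuousAt.eventually (lt_mem_nhds hn)] with s hs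
      refine h0 _ ⟨i, ?_⟩
      rw [norm_sub_coe_eq_abs_equivIoc] at hs
      exact hs.le
    exact (continuousAt_const (y := (0 : ℂ))).congr (hev.mono fun s hs => hs.symm)
  · push Not at ht
    refine hc.continuousAt.comp (continuousAt_pi.2 fun i => ?_)
    have hi : ContinuousAt (fun r : UnitAddCircle => (AddCircle.equivIoc 1 (a i - 1 / 2) r : ℝ))
        (t i) := continuous_subtype_val.continuousAt.comp
      (AddCircle.continuousAt_equivIoc 1 (a i - 1 / 2) (ht i))
    exact ContinuousAt.comp (f := fun s : UnitAddTorus κ => s i) hi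
      (continuous_apply i).continuousAt

theorem mFourier_coe (j : κ → ℤ) (z : κ → ℝ) :
    UnitAddTorus.mFourier j (fun i => (z i : UnitAddCircle))
      = Real.fourierChar (∑ i, (j i : ℝ) * z i) := by
  simp only [UnitAddTorus.mFourier, ContinuousMap.coe_mk, fourier_coe_apply, Real.fourierChar_apply]
  rw [← Complex.exp_sum]
  congr 1
  push_cast
  rw [Finset.mul_sum, Finset.sum_mul]
  exact Finset.sum_congr rfl fun i _ => by ring

/-- A continuous function supported in the cube of side `1/2` centred at `a` is the sum of its
Fourier series on the cube of side `1`. -/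
theorem hasSum_fourier_of_supported {a : κ → ℝ} {h : (κ → ℝ) → ℂ} (hc : Continuous h)
    (h0 : ∀ z, (∃ i, 1 / 4 ≤ |z i - a i|) → h z = 0)
    (hs : Summable fun j : κ → ℤ => ∫ z : κ → ℝ,
        (Real.fourierChar (-∑ i, (j i : ℝ) * z i) : ℂ) * h z)
    {x : κ → ℝ} (hx : ∀ i, |x i - a i| < 1 / 2) :
    HasSum (fun j : κ → ℤ => (∫ z : κ → ℝ, (Real.fourierChar (-∑ i, (j i : ℝ) * z i) : ℂ) * h z) *
      Real.fourierChar (∑ i, (j i : ℝ) * x i)) (h x) := by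
  let G : C(UnitAddTorus κ, ℂ) := ⟨torusLift a h, continuous_torusLift hc h0⟩
  have hcoeff : ∀ j : κ → ℤ, UnitAddTorus.mFourierCoeff G j
      = ∫ z : κ → ℝ, (Real.fourierChar (-∑ i, (j i : ℝ) * z i) : ℂ) * h z := by
    intro j
    rw [UnitAddTorus.mFourierCoeff_eq_integral _ _ fun i => a i - 1 / 2]
    have hm : MeasurableSet {z : κ → ℝ | ∀ i, z i ∈ Set.Ioc (a i - 1 / 2) (a i - 1 / 2 + 1)} :=
      MeasurableSet.univ_pi' fun i => measurableSet_Ioc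
    refine Eq.trans ?_ (setIntegral_eq_integral_of_forall_compl_eq_zero
      (s := {z : κ → ℝ | ∀ i, z i ∈ Set.Ioc (a i - 1 / 2) (a i - 1 / 2 + 1)}) ?_)
    · refine setIntegral_congr_fun hm fun z hz => ?_
      simp only [mFourier_coe, smul_eq_mul]
      congr 1
      · simp
      · exact torusLift_coe h hz
    · intro z hz
      rw [h0 z, mul_zero]
      simp only [Set.mem_ofPred_eq, not_forall] at hz
      obtain ⟨i, hi⟩ := hz
      refine ⟨i, ?_⟩
      by_contra hlt
      rw [not_le, abs_lt] at hlt
      exact hi ⟨by linarith [hlt.1], by linarith [hlt.2]⟩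
  have hsum := UnitAddTorus.hasSum_mFourier_series_apply_of_summable (f := G)
    (by simpa only [funext hcoeff] using hs) fun i => (x i : UnitAddCircle)
  have hGx : G (fun i => (x i : UnitAddCircle)) = h x := torusLift_coe h fun i => by
    have := abs_lt.1 (hx i)
    exact ⟨by linarith [this.1], by linarith [this.2]⟩
  simpa only [hGx, hcoeff, mFourier_coe, smul_eq_mul] using hsum

end Torus

section Lattice

variable {κ : Type*} [Fintype κ]

theorem summable_prod_pi {g : ℤ → ℝ} (hg0 : ∀ m, 0 ≤ g m) (hg : Summable g) :
    Summable fun k : κ → ℤ => ∏ i, g (k i) := by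
  classical
  refine summable_of_sum_le (c := ∏ _i : κ, ∑' m, g m)
    (fun k => Finset.prod_nonneg fun i _ => hg0 _) fun u => ?_
  calc ∑ k ∈ u, ∏ i, g (k i)
      ≤ ∑ k ∈ Fintype.piFinset fun i => u.image fun k => k i, ∏ i, g (k i) :=
        Finset.sum_le_sum_of_subset_of_nonneg
          (fun k hk => Fintype.mem_piFinset.2 fun i => Finset.mem_image_of_mem _ hk)
          fun k _ _ => Finset.prod_nonneg fun i _ => hg0 _
    _ = ∏ i, ∑ m ∈ u.image fun k => k i, g m := (Finset.prod_univ_sum _ _).symm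
    _ ≤ _ := Finset.prod_le_prod (fun i _ => Finset.sum_nonneg fun m _ => hg0 m)
        fun i _ => hg.sum_le_tsum _ fun m _ => hg0 m

theorem summable_inv_one_add_sq {c : ℝ} (hc : 0 < c) :
    Summable fun m : ℤ => ((1 + |c * m|) ^ 2)⁻¹ := by
  have h1 : Summable fun m : ℤ => (c ^ 2)⁻¹ * (1 / (m : ℝ) ^ 2) + if m = 0 then 1 else 0 :=
    ((Real.summable_one_div_int_pow.2 one_lt_two).mul_left _).add (hasSum_ite_eq 0 1).summable
  refine Summable.of_nonneg_of_le (fun m => by positivity) (fun m => ?_) h1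
  by_cases hm : m = 0
  · simp [hm]
  · have hm' : (m : ℝ) ≠ 0 := by exact_mod_cast hm
    rw [if_neg hm, add_zero, one_div, ← mul_inv, ← mul_pow, ← sq_abs (c * m)]
    have : 0 < |c * m| := abs_pos.2 (mul_ne_zero hc.ne' hm')
    gcongr
    linarith

variable {V : Type*} [NormedAddCommGroup V] [InnerProductSpace ℝ V]

/-- The point of the lattice `c ℤ^κ` with the given integer coordinates with respect to `b`. -/
def latticePoint (b : OrthonormalBasis κ ℝ V) (c : ℝ) (k : κ → ℤ) : V :=
  b.repr.symm (WithLp.toLp 2 fun i => c * k i)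

theorem repr_latticePoint (b : OrthonormalBasis κ ℝ V) (c : ℝ) (k : κ → ℤ) (i : κ) :
    b.repr (latticePoint b c k) i = c * k i := by
  simp [latticePoint]

theorem abs_repr_le_norm (b : OrthonormalBasis κ ℝ V) (x : V) (i : κ) : |b.repr x i| ≤ ‖x‖ := by
  rw [← b.repr.norm_map x]
  exact PiLp.norm_apply_le (b.repr x) i

theorem inner_eq_sum_repr (b : OrthonormalBasis κ ℝ V) (x y : V) :
    inner ℝ x y = ∑ i, b.repr x i * b.repr y i := by
  rw [← b.repr.inner_map_map, PiLp.inner_apply]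
  exact Finset.sum_congr rfl fun i _ => by simp [mul_comm]

theorem summable_latticePoint (b : OrthonormalBasis κ ℝ V) {c : ℝ} (hc : 0 < c) :
    Summable fun k : κ → ℤ => ((1 + ‖latticePoint b c k‖) ^ (2 * Fintype.card κ))⁻¹ := by
  refine Summable.of_nonneg_of_le (fun k => by positivity) (fun k => ?_)
    (summable_prod_pi (fun m => by positivity) (summable_inv_one_add_sq hc))
  rw [Finset.prod_inv_distrib, pow_mul, ← Finset.card_univ, ← Finset.prod_const]
  gcongr with i
  rw [← repr_latticePoint b c k i]
  exact abs_repr_le_norm b _ i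

end Lattice

section Bump

/-- A smooth bump whose translates by `ℤ/4` form a partition of unity. -/
def partitionBump (t : ℝ) : ℝ := Real.smoothTransition (1 + 4 * t) - Real.smoothTransition (4 * t)

/-- A smooth bump supported in `[-1/2, 1/2]` which is `1` on `[-1/4, 1/4]`. -/
def plateauBump (t : ℝ) : ℝ := Real.smoothTransition (2 - 4 * t) * Real.smoothTransition (2 + 4 * t)

theorem contDiff_partitionBump : ContDiff ℝ ∞ partitionBump :=
  (Real.smoothTransition.contDiff.comp (by fun_prop)).sub
    (Real.smoothTransition.contDiff.comp (by fun_prop))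

theorem contDiff_plateauBump : ContDiff ℝ ∞ plateauBump :=
  (Real.smoothTransition.contDiff.comp (by fun_prop)).mul
    (Real.smoothTransition.contDiff.comp (by fun_prop))

theorem partitionBump_eq_zero {t : ℝ} (ht : 1 / 4 ≤ |t|) : partitionBump t = 0 := by
  rcases le_abs.1 ht with h | h
  · rw [partitionBump, Real.smoothTransition.one_of_one_le (by linarith),
      Real.smoothTransition.one_of_one_le (by linarith), sub_self]
  · rw [partitionBump, Real.smoothTransition.zero_of_nonpos (by linarith),
      Real.smoothTransition.zero_of_nonpos (by linarith), sub_self]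

theorem plateauBump_eq_zero {t : ℝ} (ht : 1 / 2 ≤ |t|) : plateauBump t = 0 := by
  rcases le_abs.1 ht with h | h
  · rw [plateauBump, Real.smoothTransition.zero_of_nonpos (by linarith), zero_mul]
  · rw [plateauBump, Real.smoothTransition.zero_of_nonpos (x := 2 + 4 * t) (by linarith), mul_zero]

theorem plateauBump_eq_one {t : ℝ} (ht : |t| ≤ 1 / 4) : plateauBump t = 1 := by
  have := abs_le.1 ht
  rw [plateauBump, Real.smoothTransition.one_of_one_le (by linarith),
    Real.smoothTransition.one_of_one_le (by linarith), mul_one]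

theorem exists_finset_partitionBump (t : ℝ) : ∃ S : Finset ℤ,
    (∀ k ∉ S, partitionBump (t - 1 / 4 * k) = 0) ∧ ∑ k ∈ S, partitionBump (t - 1 / 4 * k) = 1 := by
  refine ⟨{⌊4 * t⌋, ⌊4 * t⌋ + 1}, fun k hk => partitionBump_eq_zero ?_, ?_⟩
  · have h1 := Int.floor_le (4 * t)
    have h2 := Int.lt_floor_add_one (4 * t)
    simp only [Finset.mem_insert, Finset.mem_singleton, not_or] at hk
    rcases lt_or_ge k ⌊4 * t⌋ with h | h
    · have : (k : ℝ) + 1 ≤ ⌊4 * t⌋ := by exact_mod_cast h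
      exact le_abs.2 (Or.inl (by linarith))
    · have : ⌊4 * t⌋ + 2 ≤ k := by omega
      have : (⌊4 * t⌋ : ℝ) + 2 ≤ k := by exact_mod_cast this
      exact le_abs.2 (Or.inr (by linarith))
  · have h1 := Int.floor_le (4 * t)
    have h2 := Int.lt_floor_add_one (4 * t)
    rw [Finset.sum_pair (by omega), partitionBump, partitionBump,
      Real.smoothTransition.one_of_one_le (x := 1 + 4 * (t - 1 / 4 * (⌊4 * t⌋ : ℤ))) (by linarith),
      Real.smoothTransition.zero_of_nonpos (x := 4 * (t - 1 / 4 * ((⌊4 * t⌋ + 1 : ℤ) : ℝ)))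
        (by push_cast; linarith)]
    have : 1 + 4 * (t - 1 / 4 * ((⌊4 * t⌋ + 1 : ℤ) : ℝ)) = 4 * (t - 1 / 4 * (⌊4 * t⌋ : ℤ)) := by
      push_cast; ring
    rw [this]
    ring

variable {κ : Type*} [Fintype κ] {V : Type*} [NormedAddCommGroup V] [InnerProductSpace ℝ V]
  [FiniteDimensional ℝ V]

/-- The product of copies of a bump function in the coordinates of an orthonormal basis. -/
def productBump (b : OrthonormalBasis κ ℝ V) (φ : ℝ → ℝ) (hφ : ContDiff ℝ ∞ φ)
    (h0 : ∀ t, 1 / 2 ≤ |t| → φ t = 0) : 𝓢(V, ℂ) :=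
  HasCompactSupport.toSchwartzMap (f := fun x => ∏ i, (φ (b.repr x i) : ℂ))
    (HasCompactSupport.intro (isCompact_closedBall 0 (Fintype.card κ)) fun x hx => by
      rw [mem_closedBall_zero_iff, not_le] at hx
      by_contra hne
      refine hx.not_ge ?_
      rw [← b.sum_repr x]
      refine (norm_sum_le _ _).trans ?_
      rw [← Finset.card_univ, Finset.card_eq_sum_ones, Nat.cast_sum]
      refine Finset.sum_le_sum fun i _ => ?_
      rw [norm_smul, b.norm_eq_one, mul_one, Nat.cast_one, Real.norm_eq_abs]
      by_contra hlt
      exact hne (Finset.prod_eq_zero (Finset.mem_univ i)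
        (by rw [h0 _ (by linarith), Complex.ofReal_zero])))
    (contDiff_prod fun i _ => Complex.ofRealCLM.contDiff.comp (hφ.comp
      ((PiLp.proj 2 (fun _ : κ => ℝ) i : EuclideanSpace ℝ κ →L[ℝ] ℝ).contDiff.comp
        b.repr.toContinuousLinearEquiv.contDiff)))

theorem productBump_apply (b : OrthonormalBasis κ ℝ V) (φ : ℝ → ℝ) (hφ : ContDiff ℝ ∞ φ)
    (h0 : ∀ t, 1 / 2 ≤ |t| → φ t = 0) (x : V) :
    productBump b φ hφ h0 x = ∏ i, (φ (b.repr x i) : ℂ) := rfl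

end Bump

section Gabor

variable {κ : Type*} [Fintype κ] {V : Type*} [NormedAddCommGroup V] [InnerProductSpace ℝ V]

/-- The weight of a point of the time-frequency lattice. -/
def gaborWeight (b : OrthonormalBasis κ ℝ V) (a : (κ → ℤ) × (κ → ℤ)) : ℝ :=
  (1 + ‖latticePoint b (1 / 4) a.1‖) * (1 + ‖latticePoint b 1 a.2‖)

theorem one_le_gaborWeight (b : OrthonormalBasis κ ℝ V) (a : (κ → ℤ) × (κ → ℤ)) :
    1 ≤ gaborWeight b a :=
  one_le_mul_of_one_le_of_one_le (by linarith [norm_nonneg (latticePoint b (1 / 4) a.1)])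
    (by linarith [norm_nonneg (latticePoint b 1 a.2)])

theorem summable_gaborWeight (b : OrthonormalBasis κ ℝ V) :
    Summable fun a => (gaborWeight b a ^ (2 * Fintype.card κ))⁻¹ := by
  have h := Summable.mul_of_nonneg (summable_latticePoint b (c := 1 / 4) (by norm_num))
    (summable_latticePoint b one_pos) (fun k => inv_nonneg.2 (by positivity))
    (fun k => inv_nonneg.2 (by positivity))
  refine h.congr fun a => ?_
  rw [gaborWeight, mul_pow, mul_inv]

variable [FiniteDimensional ℝ V]

/-- The partition of unity window. -/
def analysisWindow (b : OrthonormalBasis κ ℝ V) : 𝓢(V, ℂ) :=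
  productBump b partitionBump contDiff_partitionBump
    fun _ ht => partitionBump_eq_zero (by linarith)

/-- The window used for synthesis; it is `1` on the support of `analysisWindow`. -/
def synthesisWindow (b : OrthonormalBasis κ ℝ V) : 𝓢(V, ℂ) :=
  productBump b plateauBump contDiff_plateauBump fun _ => plateauBump_eq_zero

theorem hasSum_analysisWindow (b : OrthonormalBasis κ ℝ V) (x : V) :
    HasSum (fun k => analysisWindow b (x - latticePoint b (1 / 4) k)) 1 := by
  classical
  choose S hS0 hS1 using fun i => exists_finset_partitionBump (b.repr x i)
  have hval : ∀ k, analysisWindow b (x - latticePoint b (1 / 4) k)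
      = ∏ i, (partitionBump (b.repr x i - 1 / 4 * k i) : ℂ) := fun k => by
    rw [analysisWindow, productBump_apply]
    refine Finset.prod_congr rfl fun i _ => ?_
    rw [map_sub, PiLp.sub_apply, repr_latticePoint]
  have h1 : ∑ k ∈ Fintype.piFinset S, analysisWindow b (x - latticePoint b (1 / 4) k) = 1 := by
    simp only [hval]
    rw [← Finset.prod_univ_sum S fun i m => (partitionBump (b.repr x i - 1 / 4 * m) : ℂ)]
    refine Finset.prod_eq_one fun i _ => ?_
    rw [← Complex.ofReal_sum, hS1, Complex.ofReal_one]
  rw [← h1]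
  refine hasSum_sum_of_ne_finset_zero fun k hk => ?_
  simp only [Fintype.mem_piFinset, not_forall] at hk
  obtain ⟨i, hi⟩ := hk
  rw [hval]
  exact Finset.prod_eq_zero (Finset.mem_univ i) (by rw [hS0 i _ hi, Complex.ofReal_zero])

variable [MeasurableSpace V] [BorelSpace V]

theorem fourier_latticePoint (b : OrthonormalBasis κ ℝ V) (f : 𝓢(V, ℂ)) (j : κ → ℤ) :
    𝓕 f (latticePoint b 1 j) = ∫ z : κ → ℝ,
      (Real.fourierChar (-∑ i, (j i : ℝ) * z i) : ℂ) * f (b.repr.symm (WithLp.toLp 2 z)) := by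
  have hmp : MeasurePreserving (fun z : κ → ℝ => b.repr.symm (WithLp.toLp 2 z)) :=
    b.measurePreserving_repr_symm.comp (PiLp.volume_preserving_toLp κ)
  have hemb : MeasurableEmbedding (fun z : κ → ℝ => b.repr.symm (WithLp.toLp 2 z)) :=
    b.repr.symm.toHomeomorph.measurableEmbedding.comp
      (MeasurableEquiv.toLp 2 (κ → ℝ)).measurableEmbedding
  rw [SchwartzMap.fourier_coe, Real.fourier_eq, ← hmp.integral_comp hemb]
  refine integral_congr_ae (.of_forall fun z => ?_)
  simp only [Circle.smul_def, smul_eq_mul, inner_eq_sum_repr b, repr_latticePoint]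
  congr 4
  exact Finset.sum_congr rfl fun i _ => by simp [mul_comm]

/-- The Gabor coefficients of a Schwartz function. -/
def gaborCoeff (b : OrthonormalBasis κ ℝ V) (a : (κ → ℤ) × (κ → ℤ)) : 𝓢(V, ℂ) →ₗ[ℂ] ℂ :=
  shortTimeFourier (analysisWindow b) (latticePoint b (1 / 4) a.1) (latticePoint b 1 a.2)

/-- The Gabor atoms: time-frequency shifts of the synthesis window. -/
def gaborAtom (b : OrthonormalBasis κ ℝ V) (a : (κ → ℤ) × (κ → ℤ)) : 𝓢(V, ℂ) :=
  timeFreqShift (latticePoint b (1 / 4) a.1) (latticePoint b 1 a.2) (synthesisWindow b)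

theorem exists_gaborCoeff_bound (b : OrthonormalBasis κ ℝ V) (M : ℕ) :
    ∃ s : Seminorm ℂ 𝓢(V, ℂ), Continuous s ∧ ∀ a f,
      ‖gaborCoeff b a f‖ ≤ (gaborWeight b a ^ M)⁻¹ * s f := by
  obtain ⟨s, hs, h⟩ := exists_shortTimeFourier_bound (analysisWindow b) M
  refine ⟨s, hs, fun a f => ?_⟩
  rw [gaborWeight, mul_pow]
  exact h _ _ f

theorem exists_gaborAtom_bound (b : OrthonormalBasis κ ℝ V) (q : Seminorm ℂ 𝓢(V, ℂ))
    (hq : Continuous q) :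
    ∃ (M : ℕ) (C : ℝ), 0 ≤ C ∧ ∀ a, q (gaborAtom b a) ≤ C * gaborWeight b a ^ M := by
  obtain ⟨M, C, hC, h⟩ := exists_timeFreqShift_bound q hq (synthesisWindow b)
  refine ⟨M, C, hC, fun a => ?_⟩
  rw [gaborWeight, mul_pow]
  exact h _ _

theorem summable_gabor_seminorm (b : OrthonormalBasis κ ℝ V) (f : 𝓢(V, ℂ))
    (q : Seminorm ℂ 𝓢(V, ℂ)) (hq : Continuous q) :
    Summable fun a => q (gaborCoeff b a f • gaborAtom b a) := by
  obtain ⟨M, C, hC, h₁⟩ := exists_gaborAtom_bound b q hq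
  obtain ⟨s, -, h₂⟩ := exists_gaborCoeff_bound b (2 * Fintype.card κ + M)
  refine Summable.of_nonneg_of_le (fun a => apply_nonneg _ _) (fun a => ?_)
    ((summable_gaborWeight b).mul_left (s f * C))
  have hw : 0 < gaborWeight b a := zero_lt_one.trans_le (one_le_gaborWeight b a)
  rw [map_smul_eq_mul]
  refine (mul_le_mul (h₂ a f) (h₁ a) (apply_nonneg _ _)
    (mul_nonneg (by positivity) (apply_nonneg _ _))).trans_eq ?_
  rw [pow_add]
  field_simp

theorem hasSum_gabor_frequency (b : OrthonormalBasis κ ℝ V) (f : 𝓢(V, ℂ)) (k : κ → ℤ) (x : V) :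
    HasSum (fun j => gaborCoeff b (k, j) f * gaborAtom b (k, j) x)
      (analysisWindow b (x - latticePoint b (1 / 4) k) * f x) := by
  set y := latticePoint b (1 / 4) k with hy
  let g : 𝓢(V, ℂ) :=
    SchwartzMap.smulLeftCLM ℂ (SchwartzMap.compSubConstCLM ℂ y (analysisWindow b)) f
  have hg : ∀ v, g v = analysisWindow b (v - y) * f v := fun v => by
    simp only [g, SchwartzMap.smulLeftCLM_apply_apply (SchwartzMap.hasTemperateGrowth _),
      SchwartzMap.compSubConstCLM_apply, smul_eq_mul]
  have hcoeff : ∀ j, gaborCoeff b (k, j) f = 𝓕 g (latticePoint b 1 j) := fun j => rfl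
  have hatom : ∀ j, gaborAtom b (k, j) x = Real.fourierChar (∑ i, (j i : ℝ) * b.repr x i) *
      synthesisWindow b (x - y) := fun j => by
    rw [gaborAtom, timeFreqShift_apply, inner_eq_sum_repr b]
    simp only [repr_latticePoint, one_mul, hy]
  simp only [hatom, ← mul_assoc]
  by_cases hx : ∃ i, 1 / 2 ≤ |b.repr (x - y) i|
  · obtain ⟨i, hi⟩ := hx
    have h1 : synthesisWindow b (x - y) = 0 := Finset.prod_eq_zero (Finset.mem_univ i)
      (by rw [plateauBump_eq_zero hi, Complex.ofReal_zero])
    have h2 : analysisWindow b (x - y) = 0 := Finset.prod_eq_zero (Finset.mem_univ i)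
      (by rw [partitionBump_eq_zero (by linarith), Complex.ofReal_zero])
    simp only [h1, h2, mul_zero, zero_mul]
    exact hasSum_zero
  push Not at hx
  have hprod : analysisWindow b (x - y) * f x = g x * synthesisWindow b (x - y) := by
    rw [hg]
    by_cases hx' : ∃ i, 1 / 4 ≤ |b.repr (x - y) i|
    · obtain ⟨i, hi⟩ := hx'
      have h2 : analysisWindow b (x - y) = 0 := Finset.prod_eq_zero (Finset.mem_univ i)
        (by rw [partitionBump_eq_zero hi, Complex.ofReal_zero])
      simp only [h2, zero_mul]
    · push Not at hx'
      have h1 : synthesisWindow b (x - y) = 1 := Finset.prod_eq_one fun i _ => by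
        rw [plateauBump_eq_one (hx' i).le, Complex.ofReal_one]
      rw [h1, mul_one]
  rw [hprod]
  refine HasSum.mul_right _ ?_
  have hsum : Summable fun j => 𝓕 g (latticePoint b 1 j) := by
    refine Summable.of_norm_bounded ((summable_latticePoint b one_pos).mul_left
      (2 ^ (2 * Fintype.card κ) * supSeminorm V ℂ (2 * Fintype.card κ, 0) (𝓕 g))) fun j => ?_
    have e := one_add_pow_mul_le_supSeminorm (k := 2 * Fintype.card κ) (le_refl 0) (𝓕 g)
      (latticePoint b 1 j)
    rw [norm_iteratedFDeriv_zero] at e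
    rwa [← div_eq_mul_inv, le_div_iff₀' (by positivity)]
  have hF := hasSum_fourier_of_supported (a := fun i => b.repr y i)
    (h := fun z => g (b.repr.symm (WithLp.toLp 2 z)))
    (g.continuous.comp (b.repr.symm.continuous.comp (PiLp.continuous_toLp 2 _)))
    (fun z hz => by
      obtain ⟨i, hi⟩ := hz
      rw [hg, analysisWindow, productBump_apply, Finset.prod_eq_zero (Finset.mem_univ i), zero_mul]
      rw [partitionBump_eq_zero, Complex.ofReal_zero]
      simpa using hi)
    (by simpa only [← fourier_latticePoint] using hsum)
    (x := fun i => b.repr x i) (fun i => by simpa using hx i)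
  simpa [← fourier_latticePoint, hcoeff] using hF

/-- The Gabor expansion of a Schwartz function converges in the Schwartz space. -/
theorem hasSum_gabor (b : OrthonormalBasis κ ℝ V) (f : 𝓢(V, ℂ)) :
    HasSum (fun a => gaborCoeff b a f • gaborAtom b a) f := by
  refine hasSum_schwartz_of_pointwise
    (fun k l => summable_gabor_seminorm b f _ (continuous_schwartz_seminorm k l)) fun x => ?_
  have hsum : Summable fun a => (gaborCoeff b a f • gaborAtom b a) x :=
    Summable.of_norm_bounded (summable_gabor_seminorm b f _ (continuous_schwartz_seminorm 0 0))
      fun a => SchwartzMap.norm_le_seminorm ℂ _ x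
  have h1 := hsum.hasSum.prod_fiberwise fun k => hasSum_gabor_frequency b f k x
  have h2 := (hasSum_analysisWindow b x).mul_right (f x)
  rw [one_mul] at h2
  rw [← h1.unique h2]
  exact hsum.hasSum

end Gabor

section Components

theorem gaborAtom_apply {κ : Type*} [Fintype κ] {V : Type*} [NormedAddCommGroup V]
    [InnerProductSpace ℝ V] [FiniteDimensional ℝ V] [MeasurableSpace V] [BorelSpace V]
    (b : OrthonormalBasis κ ℝ V) (a : (κ → ℤ) × (κ → ℤ)) (x : V) :
    gaborAtom b a x = ∏ i, ((Real.fourierChar (a.2 i * b.repr x i) : ℂ) *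
      plateauBump (b.repr x i - 1 / 4 * a.1 i)) := by
  rw [gaborAtom, timeFreqShift_apply, inner_eq_sum_repr b, Finset.prod_mul_distrib,
    synthesisWindow, productBump_apply, Real.fourierChar_apply]
  simp only [Real.fourierChar_apply, ← Complex.exp_sum]
  simp only [repr_latticePoint, one_mul, map_sub, PiLp.sub_apply, Finset.mul_sum,
    Complex.ofReal_sum, Finset.sum_mul]

variable {E : Type*} [NormedAddCommGroup E] [NormedSpace ℝ E] {ι : Type*} [Fintype ι]

/-- A component of a vector valued Schwartz function. -/
def component (α : ι) : 𝓢(E, EuclideanSpace ℂ ι) →L[ℂ] 𝓢(E, ℂ) :=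
  SchwartzMap.postcompCLM (EuclideanSpace.proj α)

theorem component_apply (α : ι) (f : 𝓢(E, EuclideanSpace ℂ ι)) (x : E) :
    component α f x = f x α := rfl

variable [DecidableEq ι]

/-- The vector valued Schwartz function with a single nonzero component. -/
def ofComponent (α : ι) : 𝓢(E, ℂ) →L[ℂ] 𝓢(E, EuclideanSpace ℂ ι) :=
  SchwartzMap.postcompCLM (ContinuousLinearMap.toSpanSingleton ℂ (EuclideanSpace.single α (1 : ℂ)))

theorem ofComponent_apply (α β : ι) (g : 𝓢(E, ℂ)) (x : E) :
    ofComponent α g x β = if β = α then g x else 0 := by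
  simp [ofComponent]

theorem sum_ofComponent_component (f : 𝓢(E, EuclideanSpace ℂ ι)) :
    ∑ α, ofComponent α (component α f) = f := by
  ext x β
  simp [ofComponent_apply, component_apply, sum_apply]

end Components

/-- A family over a product with finite first factor is summed fibre by fibre. -/
theorem hasSum_prod_of_finite {ι A X : Type*} [Fintype ι] [DecidableEq ι] [AddCommMonoid X]
    [TopologicalSpace X] [ContinuousAdd X] {g : ι × A → X} {x : ι → X}
    (h : ∀ α, HasSum (fun a => g (α, a)) (x α)) : HasSum g (∑ α, x α) := by
  have h' : ∀ α ∈ Finset.univ, HasSum (fun z : ι × A => if z.1 = α then g z else 0) (x α) := by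
    intro α _
    rw [← (Prod.mk_right_injective α).hasSum_iff]
    · simpa [Function.comp_def] using h α
    · rintro ⟨β, a⟩ hz
      refine if_neg fun e => hz ⟨a, ?_⟩
      exact congrArg (·, a) e.symm
  have := hasSum_sum h'
  simpa using this

section Tensor

variable {d N n : ℕ}

/-- The standard orthonormal basis of the configuration space. -/
def configBasis (d n : ℕ) : OrthonormalBasis ((_ : Fin n) × Fin d) ℝ (Config d n) :=
  Pi.orthonormalBasis fun _ => EuclideanSpace.basisFun (Fin d) ℝ

theorem configBasis_repr (x : Config d n) (i : Fin n) (l : Fin d) :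
    (configBasis d n).repr x ⟨i, l⟩ = x i l := by
  exact Pi.orthonormalBasis_repr _ _ _

/-- Indices of the time-frequency lattice of `ℝ^{nd}`. -/
abbrev LatticeIndex (d n : ℕ) : Type :=
  (((_ : Fin n) × Fin d) → ℤ) × (((_ : Fin n) × Fin d) → ℤ)

/-- The part of a lattice index that belongs to the `i`-th particle. -/
def LatticeIndex.particle (a : LatticeIndex d n) (i : Fin n) :
    (Fin d → ℤ) × (Fin d → ℤ) :=
  (fun l => a.1 ⟨i, l⟩, fun l => a.2 ⟨i, l⟩)

theorem gaborAtom_configBasis (a : LatticeIndex d n) (x : Config d n) :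
    gaborAtom (configBasis d n) a x
      = ∏ i, gaborAtom (EuclideanSpace.basisFun (Fin d) ℝ) (a.particle i) (x i) := by
  simp only [gaborAtom_apply, Fintype.prod_sigma, configBasis_repr, EuclideanSpace.basisFun_repr,
    LatticeIndex.particle]

theorem gaborWeight_particle_le (a : LatticeIndex d n) (i : Fin n) :
    gaborWeight (EuclideanSpace.basisFun (Fin d) ℝ) (a.particle i)
      ≤ gaborWeight (configBasis d n) a := by
  have h : ∀ (c : ℝ) (k : ((_ : Fin n) × Fin d) → ℤ),
      ‖latticePoint (EuclideanSpace.basisFun (Fin d) ℝ) c (fun l => k ⟨i, l⟩)‖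
        ≤ ‖latticePoint (configBasis d n) c k‖ := fun c k => by
    have e : latticePoint (EuclideanSpace.basisFun (Fin d) ℝ) c (fun l => k ⟨i, l⟩)
        = latticePoint (configBasis d n) c k i := by
      ext l
      rw [← configBasis_repr, repr_latticePoint, ← EuclideanSpace.basisFun_repr (Fin d) ℝ,
        repr_latticePoint]
    rw [e]
    exact PiLp.norm_apply_le _ i
  unfold gaborWeight
  gcongr
  · exact h _ a.1
  · exact h _ a.2

/-- The one-particle Gabor atoms. -/
def particleAtom (α : Fin N) (a : (Fin d → ℤ) × (Fin d → ℤ)) : TestFun d N :=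
  ofComponent α (gaborAtom (EuclideanSpace.basisFun (Fin d) ℝ) a)

theorem tensorProd_particleAtom (α : Fin n → Fin N) (a : LatticeIndex d n) :
    tensorProd (fun i => particleAtom (α i) (a.particle i))
      = ofComponent α (gaborAtom (configBasis d n) a) := by
  ext x β
  rw [tensorProd_apply, ofComponent_apply, gaborAtom_configBasis]
  simp only [particleAtom, ofComponent_apply]
  split_ifs with h
  · exact Finset.prod_congr rfl fun i _ => if_pos (congrFun h i)
  · obtain ⟨i, hi⟩ := Function.ne_iff.1 h
    exact Finset.prod_eq_zero (Finset.mem_univ i) (if_neg hi)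

theorem exists_particleAtom_bound (p : Seminorm ℂ (TestFun d N)) (hp : Continuous p) :
    ∃ (M : ℕ) (C : ℝ), 0 ≤ C ∧ ∀ (α : Fin N) a, p (particleAtom α a)
      ≤ C * gaborWeight (EuclideanSpace.basisFun (Fin d) ℝ) a ^ M := by
  choose M C hC h using fun α : Fin N => exists_gaborAtom_bound
    (EuclideanSpace.basisFun (Fin d) ℝ) (p.comp (ofComponent α).toLinearMap)
    (hp.comp (ofComponent α).continuous)
  refine ⟨∑ α, M α, ∑ α, C α, Finset.sum_nonneg fun α _ => hC α, fun α a => ?_⟩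
  have hw := one_le_gaborWeight (EuclideanSpace.basisFun (Fin d) ℝ) a
  exact (h α a).trans (mul_le_mul
    (Finset.single_le_sum (fun α _ => hC α) (Finset.mem_univ α))
    (pow_le_pow_right₀ hw (Finset.single_le_sum (fun α _ => Nat.zero_le _) (Finset.mem_univ α)))
    (pow_nonneg (zero_le_one.trans hw) _) (Finset.sum_nonneg fun α _ => hC α))

theorem summable_gaborWeight_prod (ι : Type*) [Finite ι] {κ V : Type*} [Fintype κ]
    [NormedAddCommGroup V] [InnerProductSpace ℝ V] (b : OrthonormalBasis κ ℝ V) :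
    Summable fun a : ι × ((κ → ℤ) × (κ → ℤ)) =>
      (gaborWeight b a.2 ^ (2 * Fintype.card κ))⁻¹ := by
  classical
  have := Fintype.ofFinite ι
  have h : ∀ _α : ι, HasSum (fun a => (gaborWeight b a ^ (2 * Fintype.card κ))⁻¹)
      (∑' a, (gaborWeight b a ^ (2 * Fintype.card κ))⁻¹) := fun _ => (summable_gaborWeight b).hasSum
  exact (hasSum_prod_of_finite (g := fun a : ι × ((κ → ℤ) × (κ → ℤ)) =>
    (gaborWeight b a.2 ^ (2 * Fintype.card κ))⁻¹) h).summable

/-- Nuclear expansion of the completed tensor power: every `f` is a series of product functions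
whose coefficients are small compared to a given continuous seminorm on `𝒮`. -/
theorem exists_nuclear_expansion (p : Seminorm ℂ (TestFun d N)) (hp : Continuous p) (n : ℕ) :
    ∃ (A : Type) (e : A → Fin n → TestFun d N) (c : A → TensorTestFun d N n →ₗ[ℂ] ℂ)
      (μ : A → ℝ) (s : Seminorm ℂ (TensorTestFun d N n)),
      Continuous s ∧ Summable μ ∧ (∀ a, 0 < μ a) ∧
      (∀ a f, ‖c a f‖ * ∏ i, p (e a i) ≤ μ a * s f) ∧
      ∀ f, HasSum (fun a => c a f • tensorProd (e a)) f := by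
  let b := configBasis d n
  obtain ⟨M, C, hC, hatom⟩ := exists_particleAtom_bound p hp
  obtain ⟨s, hs, hcoeff⟩ := exists_gaborCoeff_bound b
    (2 * Fintype.card ((_ : Fin n) × Fin d) + M * n)
  have hw : ∀ a, 0 < gaborWeight b a := fun a => zero_lt_one.trans_le (one_le_gaborWeight b a)
  let S : Seminorm ℂ (TensorTestFun d N n) :=
    Finset.univ.sup fun α : Fin n → Fin N => s.comp (component α).toLinearMap
  refine ⟨(Fin n → Fin N) × LatticeIndex d n, fun a i => particleAtom (a.1 i) (a.2.particle i),
    fun a => gaborCoeff b a.2 ∘ₗ (component a.1).toLinearMap,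
    fun a => (gaborWeight b a.2 ^ (2 * Fintype.card ((_ : Fin n) × Fin d)))⁻¹,
    (C ^ n).toNNReal • S, ?_, ?_, fun a => inv_pos.2 (pow_pos (hw _) _), ?_, ?_⟩
  · have hS : Continuous S := Seminorm.continuous_finsetSup fun α _ =>
      hs.comp (component (E := Config d n) α).continuous
    exact hS.const_smul _
  · exact summable_gaborWeight_prod (Fin n → Fin N) b
  · rintro ⟨α, a⟩ f
    have h1 : ∏ i, p (particleAtom (α i) (a.particle i)) ≤ C ^ n * gaborWeight b a ^ (M * n) := by
      calc ∏ i, p (particleAtom (α i) (a.particle i)) ≤ ∏ _i : Fin n, C * gaborWeight b a ^ M := by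
            refine Finset.prod_le_prod (fun i _ => apply_nonneg _ _) fun i _ =>
              (hatom _ _).trans (mul_le_mul_of_nonneg_left ?_ hC)
            exact pow_le_pow_left₀ (zero_le_one.trans (one_le_gaborWeight _ _))
              (gaborWeight_particle_le a i) M
        _ = _ := by simp [mul_pow, pow_mul]
    have h2 : s (component α f) ≤ S f := Finset.le_sup
      (f := fun α : Fin n → Fin N => s.comp (component α).toLinearMap) (Finset.mem_univ α) f
    have hwa := hw a
    rw [smul_apply, NNReal.smul_def, smul_eq_mul, Real.coe_toNNReal _ (by positivity)]
    calc ‖gaborCoeff b a (component α f)‖ * ∏ i, p (particleAtom (α i) (a.particle i))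
        ≤ ((gaborWeight b a ^ (2 * Fintype.card ((_ : Fin n) × Fin d) + M * n))⁻¹ * S f) *
          (C ^ n * gaborWeight b a ^ (M * n)) := by
          refine mul_le_mul ((hcoeff a _).trans (mul_le_mul_of_nonneg_left h2 (by positivity))) h1
            (Finset.prod_nonneg fun i _ => apply_nonneg _ _)
            (mul_nonneg (by positivity) (apply_nonneg _ _))
      _ = _ := by
          rw [pow_add]
          field_simp
  · intro f
    have h := hasSum_prod_of_finite (g := fun a : (Fin n → Fin N) × LatticeIndex d n =>
      gaborCoeff b a.2 (component a.1 f) • ofComponent a.1 (gaborAtom b a.2)) fun α => by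
        simpa only [map_smul] using (ofComponent α).hasSum (hasSum_gabor b (component α f))
    rw [sum_ofComponent_component] at h
    simp only [tensorProd_particleAtom]
    exact h

end Tensor

section HilbertSeminorm

variable {V : Type*} [AddCommGroup V] [Module ℂ V]

/-- The semi-inner product pulled back along a linear map into a Hilbert space. -/
abbrev pullbackCore {H : Type*} [NormedAddCommGroup H] [InnerProductSpace ℂ H] (Φ : V →ₗ[ℂ] H) :
    PreInnerProductSpace.Core ℂ V where
  inner f g := inner ℂ (Φ f) (Φ g)
  conj_inner_symm f g := inner_conj_symm _ _
  re_inner_nonneg f := inner_self_nonneg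
  add_left f g h := by rw [map_add, inner_add_left]
  smul_left f g c := by rw [map_smul, inner_smul_left]

variable [TopologicalSpace V]

theorem isHilbertSeminorm_comp {H : Type*} [NormedAddCommGroup H] [InnerProductSpace ℂ H]
    (Φ : V →ₗ[ℂ] H) (hΦ : Continuous ((normSeminorm ℂ H).comp Φ)) :
    IsHilbertSeminorm ((normSeminorm ℂ H).comp Φ) where
  continuous := hΦ
  exists_inner := ⟨pullbackCore Φ, fun f => (inner_self_eq_norm_sq (𝕜 := ℂ) (Φ f)).symm⟩

variable [IsTopologicalAddGroup V]

/-- A family of functionals that is uniformly summable against a continuous seminorm is dominated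
by a Hilbert seminorm. -/
theorem exists_hilbertSeminorm_sum_le {A : Type*} (c : A → V →ₗ[ℂ] ℂ) {w μ : A → ℝ}
    (s : Seminorm ℂ V) (hs : Continuous s) (hw : ∀ a, 0 ≤ w a) (hμ : ∀ a, 0 < μ a)
    (hsum : Summable μ) (h : ∀ a f, ‖c a f‖ * w a ≤ μ a * s f) (K : ℝ) :
    ∃ q : Seminorm ℂ V, IsHilbertSeminorm q ∧
      ∀ f (u : Finset A), K * ∑ a ∈ u, ‖c a f‖ * w a ≤ q f := by
  obtain ⟨R, hR⟩ : ∃ R : ℝ, R = |K| * √(∑' a, μ a) := ⟨_, rfl⟩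
  have hR0 : 0 ≤ R := hR ▸ by positivity
  have hterm : ∀ a f, ‖c a f * ((w a / √(μ a) : ℝ) : ℂ)‖ ^ 2 ≤ μ a * s f ^ 2 := by
    intro a f
    have hsq := Real.sq_sqrt (hμ a).le
    rw [norm_mul, Complex.norm_real, Real.norm_of_nonneg (div_nonneg (hw a) (Real.sqrt_nonneg _)),
      ← mul_div_assoc, div_pow, hsq, div_le_iff₀ (hμ a)]
    calc (‖c a f‖ * w a) ^ 2 ≤ (μ a * s f) ^ 2 :=
          pow_le_pow_left₀ (mul_nonneg (norm_nonneg _) (hw a)) (h a f) 2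
      _ = _ := by ring
  have hmem : ∀ f, Memℓp (fun a => c a f * ((w a / √(μ a) : ℝ) : ℂ)) 2 := fun f => by
    refine memℓp_gen ?_
    simp only [ENNReal.toReal_ofNat, Real.rpow_two]
    exact Summable.of_nonneg_of_le (fun a => by positivity) (fun a => hterm a f)
      (hsum.mul_right _)
  let Φ : V →ₗ[ℂ] lp (fun _ : A => ℂ) 2 :=
    { toFun := fun f => ⟨fun a => c a f * ((w a / √(μ a) : ℝ) : ℂ), hmem f⟩
      map_add' := fun f g => by ext a; simp only [map_add, add_mul]; rfl
      map_smul' := fun t f => by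
        ext a; simp only [map_smul, smul_eq_mul, mul_assoc, RingHom.id_apply]; rfl }
  have hΦ_apply : ∀ f a, Φ f a = c a f * ((w a / √(μ a) : ℝ) : ℂ) := fun f a => rfl
  have hΦ_sq : ∀ f, ‖Φ f‖ ^ 2 = ∑' a, ‖Φ f a‖ ^ 2 := fun f => by
    have := lp.norm_rpow_eq_tsum (p := 2) (by norm_num) (Φ f)
    simpa only [ENNReal.toReal_ofNat, Real.rpow_two] using this
  have hΦ_summable : ∀ f, Summable fun a => ‖Φ f a‖ ^ 2 := fun f =>
    Summable.of_nonneg_of_le (fun a => by positivity) (fun a => hterm a f) (hsum.mul_right _)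
  have hΦ_le : ∀ f, ‖Φ f‖ ≤ √(∑' a, μ a) * s f := fun f => by
    refine le_of_sq_le_sq ?_ (mul_nonneg (Real.sqrt_nonneg _) (apply_nonneg _ _))
    rw [hΦ_sq, mul_pow, Real.sq_sqrt (tsum_nonneg fun a => (hμ a).le), ← tsum_mul_right]
    exact (hΦ_summable f).tsum_le_tsum (fun a => hterm a f) (hsum.mul_right _)
  have hq_apply : ∀ f, (normSeminorm ℂ (lp (fun _ : A => ℂ) 2)).comp ((R : ℂ) • Φ) f
      = R * ‖Φ f‖ := fun f => by
    rw [Seminorm.comp_apply, LinearMap.smul_apply, coe_normSeminorm, norm_smul, Complex.norm_real,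
      Real.norm_of_nonneg hR0]
  refine ⟨(normSeminorm ℂ _).comp ((R : ℂ) • Φ), isHilbertSeminorm_comp _ ?_, fun f u => ?_⟩
  · refine Seminorm.continuous_of_le
      (q := (R * √(∑' a, μ a)).toNNReal • s) (hs.const_smul _) fun f => ?_
    rw [hq_apply, smul_apply, NNReal.smul_def, smul_eq_mul, Real.coe_toNNReal _ (by positivity),
      mul_assoc R]
    exact mul_le_mul_of_nonneg_left (hΦ_le f) hR0
  · rw [hq_apply, hR, mul_assoc]
    have hsplit : ∀ a, ‖c a f‖ * w a = √(μ a) * ‖Φ f a‖ := fun a => by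
      have := Real.sqrt_pos.2 (hμ a)
      rw [hΦ_apply, norm_mul, Complex.norm_real,
        Real.norm_of_nonneg (div_nonneg (hw a) this.le)]
      field_simp
    have hcs : ∑ a ∈ u, ‖c a f‖ * w a ≤ √(∑' a, μ a) * ‖Φ f‖ := by
      simp only [hsplit]
      refine (Real.sum_mul_le_sqrt_mul_sqrt u _ _).trans ?_
      refine mul_le_mul ?_ ?_ (Real.sqrt_nonneg _) (Real.sqrt_nonneg _)
      · refine Real.sqrt_le_sqrt ?_
        simp only [Real.sq_sqrt (hμ _).le]
        exact hsum.sum_le_tsum _ fun a _ => (hμ a).le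
      · refine Real.sqrt_le_iff.2 ⟨norm_nonneg _, ?_⟩
        rw [hΦ_sq]
        exact (hΦ_summable f).sum_le_tsum _ fun a _ => by positivity
    refine mul_le_mul (le_abs_self K) hcs ?_ (abs_nonneg K)
    exact Finset.sum_nonneg fun a _ => mul_nonneg (norm_nonneg _) (hw a)

end HilbertSeminorm

section Outer

variable {E E₁ E₂ F₁ F₂ G : Type*}
  [NormedAddCommGroup E] [NormedSpace ℝ E]
  [NormedAddCommGroup E₁] [NormedSpace ℝ E₁] [NormedAddCommGroup E₂] [NormedSpace ℝ E₂]
  [NormedAddCommGroup F₁] [NormedSpace ℝ F₁] [NormedAddCommGroup F₂] [NormedSpace ℝ F₂]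
  [NormedAddCommGroup G] [NormedSpace ℝ G]

theorem continuous_schwartz_of_tendsto_zero (T : 𝓢(E₁, F₁) →ₗ[ℝ] 𝓢(E, G))
    (hT : ∀ k n : ℕ, ∃ r : 𝓢(E₁, F₁) → ℝ, Continuous r ∧ r 0 = 0 ∧
      ∀ f, SchwartzMap.seminorm ℝ k n (T f) ≤ r f) : Continuous T := by
  refine ((schwartz_withSeminorms ℝ E G).continuous_iff_continuous_comp T).2 ?_
  rintro ⟨k, n⟩
  obtain ⟨r, hr, hr0, hle⟩ := hT k n
  refine Seminorm.continuous_of_continuousAt_zero ?_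
  rw [ContinuousAt, map_zero]
  exact squeeze_zero (fun f => apply_nonneg _ _) hle (hr0 ▸ hr.tendsto 0)

variable [FiniteDimensional ℝ E]

theorem exists_seminorm_outer_le (P : E →L[ℝ] E₁) (Q : E →L[ℝ] E₂)
    (hPQ : ∀ x, P x = 0 → Q x = 0 → x = 0) (B : F₁ →L[ℝ] F₂ →L[ℝ] G) (k n : ℕ) :
    ∃ c : ℕ → ℝ, ∀ (f : 𝓢(E₁, F₁)) (h : 𝓢(E₂, F₂)),
      SchwartzMap.seminorm ℝ k n (outer P Q hPQ B f h) ≤ ∑ i ∈ Finset.range (n + 1), c i *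
        (SchwartzMap.seminorm ℝ k i f * SchwartzMap.seminorm ℝ 0 (n - i) h +
          SchwartzMap.seminorm ℝ 0 i f * SchwartzMap.seminorm ℝ k (n - i) h) := by
  obtain ⟨K, hK0, hK⟩ := exists_norm_le_of_ker P Q hPQ
  refine ⟨fun i => ‖B‖ * (K ^ k * (n.choose i * (‖P‖ ^ i * ‖Q‖ ^ (n - i)))), fun f h => ?_⟩
  refine SchwartzMap.seminorm_le_bound ℝ k n _ (Finset.sum_nonneg fun i _ => by positivity)
    fun x => ?_
  have hb := B.norm_iteratedFDeriv_le_of_bilinear (N := ∞)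
    (f := fun x => f (P x)) (g := fun x => h (Q x))
    ((f.smooth ⊤).comp P.contDiff) ((h.smooth ⊤).comp Q.contDiff) x (n := n) (mod_cast le_top)
  refine (mul_le_mul_of_nonneg_left hb (by positivity)).trans ?_
  rw [mul_left_comm, Finset.mul_sum, Finset.mul_sum]
  refine Finset.sum_le_sum fun i _ => ?_
  have h1 := norm_iteratedFDeriv_comp_le P f i x
  have h2 := norm_iteratedFDeriv_comp_le Q h (n - i) x
  have f1 := f.le_seminorm ℝ k i (P x)
  have f0 := f.le_seminorm ℝ 0 i (P x)
  have g1 := h.le_seminorm ℝ k (n - i) (Q x)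
  have g0 := h.le_seminorm ℝ 0 (n - i) (Q x)
  rw [pow_zero, one_mul] at f0 g0
  set a := ‖iteratedFDeriv ℝ i f (P x)‖ with ha
  set b := ‖iteratedFDeriv ℝ (n - i) h (Q x)‖ with hb'
  have ha0 : 0 ≤ a := norm_nonneg _
  have hb0 : 0 ≤ b := norm_nonneg _
  have hx : ‖x‖ ^ k ≤ K ^ k * (‖P x‖ ^ k + ‖Q x‖ ^ k) := by
    refine (pow_le_pow_left₀ (norm_nonneg _) (hK x) k).trans ?_
    rw [mul_pow]
    refine mul_le_mul_of_nonneg_left ?_ (by positivity)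
    rcases max_choice ‖P x‖ ‖Q x‖ with e | e <;> rw [e]
    · exact le_add_of_nonneg_right (by positivity)
    · exact le_add_of_nonneg_left (by positivity)
  calc ‖B‖ * (‖x‖ ^ k * (n.choose i * ‖iteratedFDeriv ℝ i (fun x => f (P x)) x‖ *
        ‖iteratedFDeriv ℝ (n - i) (fun x => h (Q x)) x‖))
      ≤ ‖B‖ * ((K ^ k * (‖P x‖ ^ k + ‖Q x‖ ^ k)) *
        (n.choose i * (a * ‖P‖ ^ i) * (b * ‖Q‖ ^ (n - i)))) := by gcongr
    _ = ‖B‖ * (K ^ k * (n.choose i * (‖P‖ ^ i * ‖Q‖ ^ (n - i)))) *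
        ((‖P x‖ ^ k * a) * b + a * (‖Q x‖ ^ k * b)) := by ring
    _ ≤ _ := by gcongr

/-- The bilinear map underlying `outer`. -/
def outerLinear (P : E →L[ℝ] E₁) (Q : E →L[ℝ] E₂) (hPQ : ∀ x, P x = 0 → Q x = 0 → x = 0)
    (B : F₁ →L[ℝ] F₂ →L[ℝ] G) : 𝓢(E₁, F₁) →ₗ[ℝ] 𝓢(E₂, F₂) →ₗ[ℝ] 𝓢(E, G) :=
  LinearMap.mk₂ ℝ (outer P Q hPQ B) (fun f g h => by ext x; simp) (fun c f h => by ext x; simp)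
    (fun f g h => by ext x; simp) (fun c f h => by ext x; simp)

theorem continuous_outer_left (P : E →L[ℝ] E₁) (Q : E →L[ℝ] E₂)
    (hPQ : ∀ x, P x = 0 → Q x = 0 → x = 0) (B : F₁ →L[ℝ] F₂ →L[ℝ] G) (h : 𝓢(E₂, F₂)) :
    Continuous fun f => outer P Q hPQ B f h := by
  refine continuous_schwartz_of_tendsto_zero ((outerLinear P Q hPQ B).flip h) fun k n => ?_
  obtain ⟨c, hc⟩ := exists_seminorm_outer_le P Q hPQ B k n
  refine ⟨_, ?_, ?_, fun f => hc f h⟩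
  · exact continuous_finsetSum _ fun i _ => continuous_const.mul
      ((((schwartz_withSeminorms ℝ E₁ F₁).continuous_seminorm (k, i)).mul continuous_const).add
        (((schwartz_withSeminorms ℝ E₁ F₁).continuous_seminorm (0, i)).mul continuous_const))
  · simp

theorem continuous_outer_right (P : E →L[ℝ] E₁) (Q : E →L[ℝ] E₂)
    (hPQ : ∀ x, P x = 0 → Q x = 0 → x = 0) (B : F₁ →L[ℝ] F₂ →L[ℝ] G) (f : 𝓢(E₁, F₁)) :
    Continuous fun h => outer P Q hPQ B f h := by
  refine continuous_schwartz_of_tendsto_zero (outerLinear P Q hPQ B f) fun k n => ?_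
  obtain ⟨c, hc⟩ := exists_seminorm_outer_le P Q hPQ B k n
  refine ⟨_, ?_, ?_, fun h => hc f h⟩
  · exact continuous_finsetSum _ fun i _ => continuous_const.mul
      ((continuous_const.mul ((schwartz_withSeminorms ℝ E₂ F₂).continuous_seminorm (0, n - i))).add
        (continuous_const.mul ((schwartz_withSeminorms ℝ E₂ F₂).continuous_seminorm (k, n - i))))
  · simp

end Outer

section Tensor

variable {d N n m : ℕ}

/-- `f ↦ f ⊗ h` as a continuous linear map. -/
def tensorLeft (h : TensorTestFun d N m) : TensorTestFun d N n →L[ℂ] TensorTestFun d N (n + m) where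
  toFun f := tensor f h
  map_add' f g := by ext x α; simp [tensor_apply, add_mul]
  map_smul' c f := by ext x α; simp [tensor_apply, mul_assoc]
  cont := continuous_outer_left _ _ _ _ h

/-- `h ↦ f ⊗ h` as a continuous linear map. -/
def tensorRight (f : TensorTestFun d N n) :
    TensorTestFun d N m →L[ℂ] TensorTestFun d N (n + m) where
  toFun h := tensor f h
  map_add' g h := by ext x α; simp [tensor_apply, mul_add]
  map_smul' c h := by ext x α; simp [tensor_apply, mul_left_comm]
  cont := continuous_outer_right _ _ _ _ f

theorem tensor_tensorProd (f : Fin n → TestFun d N) (g : Fin m → TestFun d N) :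
    tensor (tensorProd f) (tensorProd g) = tensorProd (Fin.append f g) := by
  ext x α
  rw [tensor_apply, tensorProd_apply, tensorProd_apply, tensorProd_apply, Fin.prod_univ_add]
  simp

/-- A continuous functional on the completed tensor power that is bounded on product functions
with respect to `p` is bounded by a Hilbert seminorm that depends only on `p`, up to a
constant; the normalization `K` of that seminorm may be prescribed. -/
theorem exists_hilbertSeminorm_bound (p : Seminorm ℂ (TestFun d N)) (hp : Continuous p) (n : ℕ)
    (K : ℝ) :
    ∃ q : Seminorm ℂ (TensorTestFun d N n), IsHilbertSeminorm q ∧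
      ∀ (L : TensorTestFun d N n →L[ℂ] ℂ) (C : ℝ), 0 ≤ C →
        (∀ g, ‖L (tensorProd g)‖ ≤ K * C * ∏ i, p (g i)) → ∀ f, ‖L f‖ ≤ C * q f := by
  obtain ⟨A, e, c, μ, s, hs, hsum, hμ, hbound, hexp⟩ := exists_nuclear_expansion p hp n
  obtain ⟨q, hq, hle⟩ := exists_hilbertSeminorm_sum_le c s hs
    (fun a => Finset.prod_nonneg fun i _ => apply_nonneg p (e a i)) hμ hsum hbound K
  refine ⟨q, hq, fun L C hC hL f => ?_⟩
  have hLf : HasSum (fun a => c a f * L (tensorProd (e a))) (L f) := by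
    simpa only [map_smul, smul_eq_mul] using L.hasSum (hexp f)
  refine le_of_tendsto hLf.norm (.of_forall fun u => ?_)
  calc ‖∑ a ∈ u, c a f * L (tensorProd (e a))‖
      ≤ ∑ a ∈ u, ‖c a f‖ * (K * C * ∏ i, p (e a i)) := by
        refine (norm_sum_le _ _).trans (Finset.sum_le_sum fun a _ => ?_)
        rw [norm_mul]
        exact mul_le_mul_of_nonneg_left (hL _) (norm_nonneg _)
    _ = C * (K * ∑ a ∈ u, ‖c a f‖ * ∏ i, p (e a i)) := by
        rw [Finset.mul_sum, Finset.mul_sum]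
        exact Finset.sum_congr rfl fun a _ => by ring
    _ ≤ C * q f := mul_le_mul_of_nonneg_left (hle f u) hC

end Tensor

section Truncation

variable {d N : ℕ}

theorem tensorNorm_tensorProd_le (p : Seminorm ℂ (TestFun d N)) {n : ℕ} (f : Fin n → TestFun d N) :
    tensorNorm p (tensorProd f) ≤ ∏ i, p (f i) := by
  refine csInf_le ⟨0, ?_⟩ ⟨1, fun _ => 1, fun _ => f, by simp, by simp⟩
  rintro r ⟨k, c, g, -, rfl⟩
  exact Finset.sum_nonneg fun j _ => mul_nonneg (norm_nonneg _)
    (Finset.prod_nonneg fun i _ => apply_nonneg _ _)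

theorem tensorNorm_nonneg (p : Seminorm ℂ (TestFun d N)) {n : ℕ} (F : TensorTestFun d N n) :
    0 ≤ tensorNorm p F := by
  refine Real.sInf_nonneg ?_
  rintro r ⟨k, c, g, -, rfl⟩
  exact Finset.sum_nonneg fun j _ => mul_nonneg (norm_nonneg _)
    (Finset.prod_nonneg fun i _ => apply_nonneg _ _)

theorem ContinuousForTensorNorm.exists_bound {p : Seminorm ℂ (TestFun d N)} {n : ℕ}
    {T : TensorTestFun d N n →L[ℂ] ℂ} (hT : ContinuousForTensorNorm p T) :
    ∃ C : ℝ, 0 ≤ C ∧ ∀ f : Fin n → TestFun d N, ‖T (tensorProd f)‖ ≤ C * ∏ i, p (f i) := by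
  obtain ⟨C, hC⟩ := hT
  refine ⟨|C|, abs_nonneg C, fun f => ?_⟩
  calc ‖T (tensorProd f)‖ ≤ C * tensorNorm p (tensorProd f) :=
        hC _ (Submodule.subset_span ⟨f, rfl⟩)
    _ ≤ |C| * tensorNorm p (tensorProd f) :=
        mul_le_mul_of_nonneg_right (le_abs_self C) (tensorNorm_nonneg p _)
    _ ≤ _ := mul_le_mul_of_nonneg_left (tensorNorm_tensorProd_le p f) (abs_nonneg C)

/-- Bounds on the truncated functionals give bounds on the full ones. -/
theorem IsTruncationOf.exists_bound {W WT : ∀ n, TensorTestFun d N n →L[ℂ] ℂ}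
    (hWT : IsTruncationOf WT W) {p : Seminorm ℂ (TestFun d N)}
    (hp : ∀ n, 1 ≤ n → ContinuousForTensorNorm p (WT n)) (n : ℕ) :
    ∃ C : ℝ, 0 ≤ C ∧ ∀ f : Fin n → TestFun d N, ‖W n (tensorProd f)‖ ≤ C * ∏ i, p (f i) := by
  rcases Nat.eq_zero_or_pos n with rfl | hn
  · refine ⟨‖W 0 (tensorProd Fin.elim0)‖, norm_nonneg _, fun f => ?_⟩
    rw [Subsingleton.elim f Fin.elim0]
    simp
  choose! C hC0 hC using fun l (hl : 1 ≤ l) => (hp l hl).exists_bound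
  refine ⟨∑ I : Finpartition (Finset.univ : Finset (Fin n)), ∏ b ∈ I.parts, C b.card,
    Finset.sum_nonneg fun I _ => Finset.prod_nonneg fun b hb =>
      hC0 _ (Finset.card_pos.2 (I.nonempty_of_mem_parts hb)), fun f => ?_⟩
  rw [hWT n hn f, Finset.sum_mul]
  refine (norm_sum_le _ _).trans (Finset.sum_le_sum fun I _ => ?_)
  have hprod : ∏ i, p (f i) = ∏ b ∈ I.parts, ∏ i ∈ b, p (f i) := by
    have h := Finset.prod_biUnion (f := fun i => p (f i)) I.disjoint
    rwa [I.biUnion_parts] at h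
  rw [norm_prod, hprod, ← Finset.prod_mul_distrib]
  refine Finset.prod_le_prod (fun b _ => norm_nonneg _) fun b hb => ?_
  refine (hC _ (Finset.card_pos.2 (I.nonempty_of_mem_parts hb)) _).trans_eq ?_
  congr 1
  conv_rhs => rw [← Finset.map_orderEmbOfFin_univ b rfl, Finset.prod_map]
  rfl

/-- If the truncated functionals are continuous for the tensor powers of one Schwartz norm, then
the Hilbert space structure condition holds. -/
theorem IsTruncationOf.hilbertSpaceStructureCondition {W WT : ∀ n, TensorTestFun d N n →L[ℂ] ℂ}
    (hWT : IsTruncationOf WT W)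
    (hcont : ∃ p : Seminorm ℂ (TestFun d N), IsSchwartzNorm p ∧
      ∀ n, 1 ≤ n → ContinuousForTensorNorm p (WT n)) :
    HilbertSpaceStructureCondition W := by
  obtain ⟨p, hp, hpT⟩ := hcont
  choose C hC0 hC using hWT.exists_bound hpT
  let K : ℕ → ℝ := fun n => 1 + ∑ k ∈ Finset.range (2 * n + 1), C k
  have hK1 : ∀ n, 1 ≤ K n := fun n =>
    le_add_of_nonneg_right (Finset.sum_nonneg fun k _ => hC0 k)
  have hCK : ∀ k n, k ≤ 2 * n → C k ≤ K n := fun k n hk =>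
    (Finset.single_le_sum (fun k _ => hC0 k) (Finset.mem_range.2 (Nat.lt_succ_of_le hk))).trans
      (le_add_of_nonneg_left zero_le_one)
  have hCmul : ∀ n m, C (n + m) ≤ K n * K m := fun n m => by
    rcases le_total n m with h | h
    · exact (hCK (n + m) m (by omega)).trans
        (le_mul_of_one_le_left (zero_le_one.trans (hK1 m)) (hK1 n))
    · exact (hCK (n + m) n (by omega)).trans
        (le_mul_of_one_le_right (zero_le_one.trans (hK1 n)) (hK1 m))
  choose q hq hqL using fun n => exists_hilbertSeminorm_bound p hp.continuous n (K n)
  refine ⟨q, hq, fun n m f h => ?_⟩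
  have hp0 : ∀ {k : ℕ} (g : Fin k → TestFun d N), 0 ≤ ∏ i, p (g i) := fun g =>
    Finset.prod_nonneg fun i _ => apply_nonneg _ _
  have h₁ : ∀ g : Fin n → TestFun d N, ‖W (n + m) (tensor (tensorProd g) h)‖
      ≤ (K n * ∏ i, p (g i)) * q m h := fun g =>
    hqL m ((W (n + m)).comp (tensorRight (tensorProd g))) _
      (mul_nonneg (zero_le_one.trans (hK1 n)) (hp0 g)) (fun g' => by
        change ‖W (n + m) (tensor (tensorProd g) (tensorProd g'))‖ ≤ _
        rw [tensor_tensorProd]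
        refine (hC (n + m) _).trans ?_
        simp only [Fin.prod_univ_add, Fin.append_left, Fin.append_right]
        refine (mul_le_mul_of_nonneg_right (hCmul n m)
          (mul_nonneg (hp0 g) (hp0 g'))).trans_eq ?_
        ring) h
  have h₂ := hqL n ((W (n + m)).comp (tensorLeft h)) (q m h) (apply_nonneg _ _)
    (fun g => (h₁ g).trans_eq (by ring)) f
  rw [mul_comm]
  exact h₂

end Truncation

end Wightman

end

theorem theorem1 (d N : ℕ) (W WT : ∀ n, Wightman.TensorTestFun d N n →L[ℂ] ℂ)
    (hWT : Wightman.IsTruncationOf WT W)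
    (hcont : ∃ p : Seminorm ℂ (Wightman.TestFun d N), Wightman.IsSchwartzNorm p ∧
      ∀ n, 1 ≤ n → Wightman.ContinuousForTensorNorm p (WT n)) :
    Wightman.HilbertSpaceStructureCondition W := by
  exact hWT.hilbertSpaceStructureCondition hcont
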